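/- Let $J$ be a finite-dimensional real Jordan algebra (not necessarily unital), i.e. a finite-dimensional real vector space with a symmetric bilinear product $\{\cdot,\cdot\}$ satisfying $\{\{x,y\},\{x,x\}\}=\{x,\{y,\{x,x\}\}\}$, and let $\xi\in J^*$. Write $l_x(y)=\{x,y\}$. Notation. Let $\mathcal H^J$ be the smooth generalized distribution on $J^*$ with $\mathcal H^J_\eta=\{\eta\circ l_x\mid x\in J\}\subset T_\eta J^*\cong J^*$. It is *involutive at* $\xi$ if $[X,Y]_\xi\in\mathcal H^J_\xi$ for all smooth vector fields $X,Y$ on $J^*$ with values in $\mathcal H^J$. An *integral leaf* is an (injectively) immersed submanifold $N\subset J^*$ with $T_\eta N=\mathcal H^J_\eta$ for all $\eta\in N$; $\mathcal H^J$ is *integrable at* $\xi$ if some integral leaf contains $\xi$. The *maximal integral leaf through* $\xi$ is the connected integral leaf through $\xi$ that contains every connected integral leaf through $\xi$ as an open submanifold. Let $\mathrm{Der}_0(J)=\mathrm{span}\{[l_x,l_y]\mid x,y\in J\}\subset\mathfrak{gl}(J)$. The extended structure Lie algebra is $\hat{\mathfrak g}(J)=\mathrm{Der}_0(J)\oplus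 J$ with the bracket given by the commutator on $\mathrm{Der}_0(J)$, $[d,x]=-[x,d]=d(x)$ and $[x,y]=[l_x,l_y]$ for $d\in\mathrm{Der}_0(J)$, $x,y\in J$. It acts on $J$ by $\phi(d)=d$, $\phi(x)=l_x$, and on $J^*$ by the dual action $X\cdot\xi=-\xi\circ\phi(X)$. Let $\mathfrak m_J=\{l_x\mid x\in J\}$, let $\mathfrak g(J)\subset\mathfrak{gl}(J)$ be the Lie subalgebra generated by $\mathfrak m_J$, and let $G(J)\subset GL(J)$ be the connected Lie subgroup with Lie algebra $\mathfrak g(J)$, acting on $J^*$ by the dual representation. Let $\mathcal O=G(J)\cdot\xi$, with its topology and manifold structure as a homogeneous space of $G(J)$, and let $\mathcal O^{\mathrm{reg}}=\{\eta\in\mathcal O\mid \mathfrak m_J\cdot\eta=T_\eta\mathcal O=\mathfrak g(J)\cdot\eta\}$, where $X\cdot\eta=-\eta\circ X$ for $X\in\mathfrak{gl}(J)$. Proposition. The following are equivalent: 1. $\mathcal H^J$ is involutive at $\xi$; 2. $\mathcal H^J$ is integrable at $\xi$; 3. $\mathrm{Der}_0(J)\cdot\xi\subset J\cdot\xi$ (dual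 action of $\mathrm{Der}_0(J),J\subset\hat{\mathfrak g}(J)$ on $J^*$). If these hold, then the maximal integral leaf through $\xi$ exists, and it is the connected component of $\xi$ in $\mathcal O^{\mathrm{reg}}$, as an open submanifold of $\mathcal O$. -/

import Mathlib

open scoped Manifold ContDiff Topology

universe u

namespace JordanDist

noncomputable section

attribute [local instance] LieRing.ofAssociativeRing

/-! ## Generalized distributions on a vector space

The ambient manifold is a real normed space `E` (only its topology and linear structure matter when
`E` is finite-dimensional); every tangent space `T_p E` is identified with `E`. -/

/-- `X` is a smooth vector field on `E` taking values in the family of subspaces `D`. -/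
def IsSection {E : Type u} [NormedAddCommGroup E] [NormedSpace ℝ E]
    (D : E → Submodule ℝ E) (X : E → E) : Prop :=
  ContDiff ℝ ∞ X ∧ ∀ p, X p ∈ D p

/-- A smooth generalized distribution: a family of subspaces `D_p ⊆ T_p E` such that every
`v ∈ D_p` is the value at `p` of a smooth vector field with values in `D`. -/
structure SmoothDistribution (E : Type u) [NormedAddCommGroup E] [NormedSpace ℝ E] where
  fiber : E → Submodule ℝ E
  smooth : ∀ p, ∀ v ∈ fiber p, ∃ X : E → E, IsSection fiber X ∧ X p = v

/-- Involutivity at `p`: the Frobenius tensor `(X_p, Y_p) ↦ [X, Y]_p mod D_p` vanishes, for all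
smooth vector fields `X`, `Y` with values in `D`. -/
def InvolutiveAt {E : Type u} [NormedAddCommGroup E] [NormedSpace ℝ E]
    (D : SmoothDistribution E) (p : E) : Prop :=
  ∀ X Y : E → E, IsSection D.fiber X → IsSection D.fiber Y →
    VectorField.lieBracket ℝ X Y p ∈ D.fiber p

/-- An immersed submanifold of `E`: a smooth manifold (Hausdorff, second countable, without
boundary) together with a smooth injective immersion into `E`. Up to the obvious identification this
is a subset of `E` (the range of `incl`) with a manifold structure for which the inclusion is an
immersion; its topology may be finer than the subspace topology. -/
structure ImmersedSubmanifold (E : Type u) [NormedAddCommGroup E] [NormedSpace ℝ E] where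
  carrier : Type u
  dim : ℕ
  [topology : TopologicalSpace carrier]
  [t2 : T2Space carrier]
  [secondCountable : SecondCountableTopology carrier]
  [charted : ChartedSpace (EuclideanSpace ℝ (Fin dim)) carrier]
  [manifold : IsManifold (𝓡 dim) ∞ carrier]
  incl : carrier → E
  injective : Function.Injective incl
  contMDiff : ContMDiff (𝓡 dim) 𝓘(ℝ, E) ∞ incl
  immersion : ∀ x, Function.Injective (mfderiv (𝓡 dim) 𝓘(ℝ, E) incl x)

attribute [instance] ImmersedSubmanifold.topology ImmersedSubmanifold.t2
  ImmersedSubmanifold.secondCountable ImmersedSubmanifold.charted ImmersedSubmanifold.manifold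

/-- The tangent space of an immersed submanifold, as a subspace of `E`. -/
def ImmersedSubmanifold.tangent {E : Type u} [NormedAddCommGroup E] [NormedSpace ℝ E]
    (N : ImmersedSubmanifold E) (x : N.carrier) : Submodule ℝ E :=
  LinearMap.range
    (mfderiv (𝓡 N.dim) 𝓘(ℝ, E) N.incl x :
      EuclideanSpace ℝ (Fin N.dim) →L[ℝ] E).toLinearMap

/-- `N` is an integral leaf of `D`: `T_p N = D_p` for all `p ∈ N`. -/
def IsIntegralLeaf {E : Type u} [NormedAddCommGroup E] [NormedSpace ℝ E]
    (D : SmoothDistribution E) (N : ImmersedSubmanifold E) : Prop :=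
  ∀ x : N.carrier, N.tangent x = D.fiber (N.incl x)

/-- `D` is integrable at `p`: some integral leaf contains `p`. -/
def IntegrableAt {E : Type u} [NormedAddCommGroup E] [NormedSpace ℝ E]
    (D : SmoothDistribution E) (p : E) : Prop :=
  ∃ N : ImmersedSubmanifold E, IsIntegralLeaf D N ∧ p ∈ Set.range N.incl

/-- `N` is a connected integral leaf through `p`. -/
structure IsConnectedLeafThrough {E : Type u} [NormedAddCommGroup E] [NormedSpace ℝ E]
    (D : SmoothDistribution E) (p : E) (N : ImmersedSubmanifold E) : Prop where
  leaf : IsIntegralLeaf D N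
  connected : ConnectedSpace N.carrier
  mem : p ∈ Set.range N.incl

/-- `N` is the maximal integral leaf through `p`: a connected integral leaf through `p` which
contains every connected integral leaf through `p` as an open submanifold. -/
structure IsMaximalLeafThrough {E : Type u} [NormedAddCommGroup E] [NormedSpace ℝ E]
    (D : SmoothDistribution E) (p : E) (N : ImmersedSubmanifold E) : Prop
    extends IsConnectedLeafThrough D p N where
  maximal : ∀ N' : ImmersedSubmanifold E, IsConnectedLeafThrough D p N' →
    ∃ j : N'.carrier → N.carrier, Topology.IsOpenEmbedding j ∧ ∀ x, N.incl (j x) = N'.incl x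

/-! ## Algebras, the dual distribution and the structure group

An algebra is a finite-dimensional real vector space `A` with a bilinear product `mul`. The norm on
`A` is auxiliary (all norms on `A` are equivalent): it provides the topology and smooth structure of
`A`, of `A* = StrongDual ℝ A` and of `gl(A) = A →L[ℝ] A`, which consist of all linear functionals
and of all linear endomorphisms. -/

/-- The left multiplications `a ↦ l_a ∈ gl(A)`, `l_a b = a • b`. -/
def lmul {A : Type u} [NormedAddCommGroup A] [NormedSpace ℝ A] [FiniteDimensional ℝ A]
    (mul : A →ₗ[ℝ] A →ₗ[ℝ] A) : A →ₗ[ℝ] (A →L[ℝ] A) :=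
  (LinearMap.toContinuousLinearMap : (A →ₗ[ℝ] A) ≃ₗ[ℝ] (A →L[ℝ] A)).toLinearMap ∘ₗ mul

@[simp]
theorem lmul_apply {A : Type u} [NormedAddCommGroup A] [NormedSpace ℝ A] [FiniteDimensional ℝ A]
    (mul : A →ₗ[ℝ] A →ₗ[ℝ] A) (a b : A) : lmul mul a b = mul a b := rfl

/-- The map `♯_ξ : T*_ξ A* = A → T_ξ A* = A*`, `⟨♯_ξ a, b⟩ = ⟨ξ, a • b⟩`. -/
def sharp {A : Type u} [NormedAddCommGroup A] [NormedSpace ℝ A] [FiniteDimensional ℝ A]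
    (mul : A →ₗ[ℝ] A →ₗ[ℝ] A) (ξ : StrongDual ℝ A) : A →ₗ[ℝ] StrongDual ℝ A where
  toFun a := ξ.comp (lmul mul a)
  map_add' a b := by ext; simp
  map_smul' c a := by ext; simp

@[simp]
theorem sharp_apply {A : Type u} [NormedAddCommGroup A] [NormedSpace ℝ A] [FiniteDimensional ℝ A]
    (mul : A →ₗ[ℝ] A →ₗ[ℝ] A) (ξ : StrongDual ℝ A) (a b : A) :
    sharp mul ξ a b = ξ (mul a b) := rfl

/-- The `A`-dual distribution `H^A` on `A*`, `H^A_ξ = im ♯_ξ`. -/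
def dualDistribution {A : Type u} [NormedAddCommGroup A] [NormedSpace ℝ A] [FiniteDimensional ℝ A]
    (mul : A →ₗ[ℝ] A →ₗ[ℝ] A) : SmoothDistribution (StrongDual ℝ A) where
  fiber ξ := LinearMap.range (sharp mul ξ)
  smooth := by
    rintro ξ v ⟨a, rfl⟩
    refine ⟨fun η => sharp mul η a, ⟨?_, fun η => ⟨a, rfl⟩⟩, rfl⟩
    exact ContDiff.clm_comp contDiff_id contDiff_const

/-- The dual action of `X ∈ gl(A)` on `A*`, `X · ξ = -ξ ∘ X`, as a linear function of `X`. -/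
def dualAct {A : Type u} [NormedAddCommGroup A] [NormedSpace ℝ A]
    (ξ : StrongDual ℝ A) : (A →L[ℝ] A) →ₗ[ℝ] StrongDual ℝ A where
  toFun X := -(ξ.comp X)
  map_add' X Y := by ext; simp; abel
  map_smul' c X := by ext; simp

/-- `m_A = {l_a | a ∈ A} ⊆ gl(A)`. -/
def leftMultiplications {A : Type u} [NormedAddCommGroup A] [NormedSpace ℝ A]
    [FiniteDimensional ℝ A] (mul : A →ₗ[ℝ] A →ₗ[ℝ] A) : Submodule ℝ (A →L[ℝ] A) :=
  LinearMap.range (lmul mul)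

/-- The structure Lie algebra `g(A)`: the Lie subalgebra of `gl(A)` generated by `m_A`. -/
def structureAlgebra {A : Type u} [NormedAddCommGroup A] [NormedSpace ℝ A]
    [FiniteDimensional ℝ A] (mul : A →ₗ[ℝ] A →ₗ[ℝ] A) : LieSubalgebra ℝ (A →L[ℝ] A) :=
  LieSubalgebra.lieSpan ℝ (A →L[ℝ] A) (leftMultiplications mul)

/-- The exponential `exp X` as an element of `Gl(A)`. -/
def expUnit {A : Type u} [NormedAddCommGroup A] [NormedSpace ℝ A] [FiniteDimensional ℝ A]
    (X : A →L[ℝ] A) : (A →L[ℝ] A)ˣ :=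
  letI : CompleteSpace A := FiniteDimensional.complete ℝ A
  letI : NormedAlgebra ℚ (A →L[ℝ] A) := NormedAlgebra.restrictScalars ℚ ℝ (A →L[ℝ] A)
  (NormedSpace.isUnit_exp X).unit

@[simp]
theorem coe_expUnit {A : Type u} [NormedAddCommGroup A] [NormedSpace ℝ A] [FiniteDimensional ℝ A]
    (X : A →L[ℝ] A) : (expUnit X : A →L[ℝ] A) = NormedSpace.exp X := rfl

/-- The structure group `G(A)`: the connected Lie subgroup of `Gl(A)` with Lie algebra `g(A)`,
that is, the subgroup generated by `exp (g(A))`. -/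
def structureGroup {A : Type u} [NormedAddCommGroup A] [NormedSpace ℝ A]
    [FiniteDimensional ℝ A] (mul : A →ₗ[ℝ] A →ₗ[ℝ] A) : Subgroup (A →L[ℝ] A)ˣ :=
  Subgroup.closure (expUnit '' (structureAlgebra mul : Set (A →L[ℝ] A)))

/-- The exponential map `g(A) → G(A)`. -/
def structureExp {A : Type u} [NormedAddCommGroup A] [NormedSpace ℝ A]
    [FiniteDimensional ℝ A] (mul : A →ₗ[ℝ] A →ₗ[ℝ] A) (X : structureAlgebra mul) :
    structureGroup mul :=
  ⟨expUnit X.1, Subgroup.subset_closure ⟨X.1, X.2, rfl⟩⟩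

/-- The topology of the Lie group `G(A)` (in general finer than the topology induced by `Gl(A)`):
the maps `X ↦ g exp X` on `g(A)` are local homeomorphisms at `0`, so `U` is open iff for all `g ∈ U`
one has `g exp X ∈ U` for all `X` near `0` in `g(A)`. -/
abbrev structureGroupTopology {A : Type u} [NormedAddCommGroup A] [NormedSpace ℝ A]
    [FiniteDimensional ℝ A] (mul : A →ₗ[ℝ] A →ₗ[ℝ] A) :
    TopologicalSpace (structureGroup mul) where
  IsOpen U := ∀ g ∈ U, ∀ᶠ X in 𝓝 (0 : structureAlgebra mul), g * structureExp mul X ∈ U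
  isOpen_univ := fun _ _ => Filter.Eventually.of_forall fun _ => trivial
  isOpen_inter := fun _ _ hU hV g hg => (hU g hg.1).and (hV g hg.2)
  isOpen_sUnion := fun _ hS g ⟨U, hU, hg⟩ => (hS U hU g hg).mono fun _ h => ⟨U, hU, h⟩

/-- The dual representation of `Gl(A)` on `A*`: `g · ξ = ξ ∘ g⁻¹`. -/
def dualGroupAct {A : Type u} [NormedAddCommGroup A] [NormedSpace ℝ A]
    (g : (A →L[ℝ] A)ˣ) (ξ : StrongDual ℝ A) : StrongDual ℝ A :=
  ξ.comp ((g⁻¹ : (A →L[ℝ] A)ˣ) : A →L[ℝ] A)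

/-- The orbit `O = G(A) · ξ`. -/
def orbit {A : Type u} [NormedAddCommGroup A] [NormedSpace ℝ A] [FiniteDimensional ℝ A]
    (mul : A →ₗ[ℝ] A →ₗ[ℝ] A) (ξ : StrongDual ℝ A) : Set (StrongDual ℝ A) :=
  Set.range fun g : structureGroup mul => dualGroupAct g.1 ξ

/-- The topology of `O` as a homogeneous space `G(A) / H_ξ`: the quotient topology along
`g ↦ g · ξ`. -/
abbrev orbitTopology {A : Type u} [NormedAddCommGroup A] [NormedSpace ℝ A] [FiniteDimensional ℝ A]
    (mul : A →ₗ[ℝ] A →ₗ[ℝ] A) (ξ : StrongDual ℝ A) : TopologicalSpace (orbit mul ξ) :=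
  (structureGroupTopology mul).coinduced
    (Set.rangeFactorization fun g : structureGroup mul => dualGroupAct g.1 ξ)

/-- The point `ξ` of its orbit. -/
def basePoint {A : Type u} [NormedAddCommGroup A] [NormedSpace ℝ A] [FiniteDimensional ℝ A]
    (mul : A →ₗ[ℝ] A →ₗ[ℝ] A) (ξ : StrongDual ℝ A) : orbit mul ξ :=
  ⟨ξ, 1, by ext; simp [dualGroupAct]⟩

/-- `D^m_η = {X · η | X ∈ m}` for a linear subspace `m ⊆ gl(A)`; for `m = g(A)` this is the tangent
space of the `G(A)`-orbit at `η`. -/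
def orbitDistribution {A : Type u} [NormedAddCommGroup A] [NormedSpace ℝ A]
    (m : Submodule ℝ (A →L[ℝ] A)) (η : StrongDual ℝ A) : Submodule ℝ (StrongDual ℝ A) :=
  m.map (dualAct η)

/-- The set of `m_A`-regular points of `O = G(A) · ξ`, those `η` with `D^{m_A}_η = T_η O`. -/
def regularPart {A : Type u} [NormedAddCommGroup A] [NormedSpace ℝ A] [FiniteDimensional ℝ A]
    (mul : A →ₗ[ℝ] A →ₗ[ℝ] A) (ξ : StrongDual ℝ A) : Set (orbit mul ξ) :=
  {η | orbitDistribution (leftMultiplications mul) η.1 =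
    orbitDistribution (structureAlgebra mul).toSubmodule η.1}

/-- The connected component of `ξ` in the regular part of its orbit, for the topology of the
orbit. -/
def regularComponent {A : Type u} [NormedAddCommGroup A] [NormedSpace ℝ A]
    [FiniteDimensional ℝ A] (mul : A →ₗ[ℝ] A →ₗ[ℝ] A) (ξ : StrongDual ℝ A) :
    Set (orbit mul ξ) :=
  letI := orbitTopology mul ξ
  connectedComponentIn (regularPart mul ξ) (basePoint mul ξ)

/-- The immersed submanifold `N` of `A*` is the subset `S` of the orbit `O`, as an open subset of
`O` with the topology of `O` (together with the inclusion being an immersion this determines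
the smooth structure too). -/
def IsOpenPartOfOrbit {A : Type u} [NormedAddCommGroup A] [NormedSpace ℝ A]
    [FiniteDimensional ℝ A] (mul : A →ₗ[ℝ] A →ₗ[ℝ] A) (ξ : StrongDual ℝ A)
    (N : ImmersedSubmanifold (StrongDual ℝ A)) (S : Set (orbit mul ξ)) : Prop :=
  letI := orbitTopology mul ξ
  ∃ e : N.carrier → orbit mul ξ,
    Topology.IsOpenEmbedding e ∧ (∀ x, (e x : StrongDual ℝ A) = N.incl x) ∧ Set.range e = S

/-! ## Jordan algebras -/

/-- The product `mul` makes the vector space `J` a Jordan algebra (not necessarily unital). -/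
structure IsJordan {J : Type u} [AddCommGroup J] [Module ℝ J]
    (mul : J →ₗ[ℝ] J →ₗ[ℝ] J) : Prop where
  comm : ∀ x y, mul x y = mul y x
  jordan : ∀ x y, mul (mul x y) (mul x x) = mul x (mul y (mul x x))

/-- `Der₀(J)`: the span of the commutators `[l_x, l_y]` in `gl(J)`. -/
def innerDer {J : Type u} [NormedAddCommGroup J] [NormedSpace ℝ J] [FiniteDimensional ℝ J]
    (mul : J →ₗ[ℝ] J →ₗ[ℝ] J) : Submodule ℝ (J →L[ℝ] J) :=
  Submodule.span ℝ {d | ∃ x y, d = ⁅lmul mul x, lmul mul y⁆}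

section Inner

variable {J : Type u} [NormedAddCommGroup J] [NormedSpace ℝ J] [FiniteDimensional ℝ J]
  {mul : J →ₗ[ℝ] J →ₗ[ℝ] J}

theorem lie_apply (f g : J →L[ℝ] J) (b : J) : ⁅f, g⁆ b = f (g b) - g (f b) := rfl

theorem lie_lmul_mem (mul : J →ₗ[ℝ] J →ₗ[ℝ] J) (x y : J) :
    ⁅lmul mul x, lmul mul y⁆ ∈ innerDer mul :=
  Submodule.subset_span ⟨x, y, rfl⟩

theorem IsJordan.linearized (hJ : IsJordan mul) (a b c d : J) :
    mul a (mul d (mul b c)) + mul b (mul d (mul c a)) + mul c (mul d (mul a b)) =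
      mul (mul a d) (mul b c) + mul (mul b d) (mul c a) + mul (mul c d) (mul a b) := by
  have h1 := hJ.jordan (a + b + c) d
  have h2 := hJ.jordan (a + b) d
  have h3 := hJ.jordan (b + c) d
  have h4 := hJ.jordan (a + c) d
  have h5 := hJ.jordan a d
  have h6 := hJ.jordan b d
  have h7 := hJ.jordan c d
  simp only [map_add, LinearMap.add_apply, hJ.comm c b, hJ.comm a c, hJ.comm b a] at h1 h2 h3 h4 ⊢
  linear_combination (norm := module) (-(1 / 2 : ℝ)) • (h1 - h2 - h3 - h4 + h5 + h6 + h7)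

theorem innerDer_derivation (hJ : IsJordan mul) {d : J →L[ℝ] J} (hd : d ∈ innerDer mul) (b c : J) :
    d (mul b c) = mul (d b) c + mul b (d c) := by
  induction hd using Submodule.span_induction with
  | mem d hd =>
    obtain ⟨x, y, rfl⟩ := hd
    have h1 := hJ.linearized x b c y
    have h2 := hJ.linearized y b c x
    simp only [lie_apply, lmul_apply]
    rw [hJ.comm (_ - _) c]
    simp only [map_sub]
    rw [hJ.comm c x, hJ.comm x y, hJ.comm (mul b y) (mul x c)] at h1
    rw [hJ.comm c y, hJ.comm y b, hJ.comm (mul b x) (mul y c), hJ.comm c x, hJ.comm b x] at h2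
    rw [hJ.comm c y, hJ.comm b y] at h1
    rw [hJ.comm b y] at h2
    linear_combination (norm := module) h1 - h2
  | zero => simp
  | add d e _ _ hd he => simp only [add_apply, hd, he, map_add, LinearMap.add_apply]; abel
  | smul r d _ hd => simp [hd]

theorem innerDer_lie_lmul (hJ : IsJordan mul) {d : J →L[ℝ] J} (hd : d ∈ innerDer mul) (x : J) :
    ⁅d, lmul mul x⁆ = lmul mul (d x) := by
  ext b
  simp [Ring.lie_def, innerDer_derivation hJ hd]

theorem innerDer_lie_mem (hJ : IsJordan mul) {d e : J →L[ℝ] J} (hd : d ∈ innerDer mul)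
    (he : e ∈ innerDer mul) : ⁅d, e⁆ ∈ innerDer mul := by
  induction he using Submodule.span_induction with
  | mem e he =>
    obtain ⟨x, y, rfl⟩ := he
    rw [leibniz_lie, innerDer_lie_lmul hJ hd, innerDer_lie_lmul hJ hd]
    exact add_mem (lie_lmul_mem mul (d x) y) (lie_lmul_mem mul x (d y))
  | zero => simp
  | add e f _ _ he hf => rw [lie_add]; exact add_mem he hf
  | smul c e _ he => rw [lie_smul]; exact Submodule.smul_mem _ _ he

end Inner

/-- The extended structure Lie algebra `ĝ(J) = Der₀(J) ⊕ J`. -/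
@[ext]
structure ExtAlgebra {J : Type u} [NormedAddCommGroup J] [NormedSpace ℝ J] [FiniteDimensional ℝ J]
    {mul : J →ₗ[ℝ] J →ₗ[ℝ] J} (hJ : IsJordan mul) : Type u where
  der : innerDer mul
  elt : J

namespace ExtAlgebra

variable {J : Type u} [NormedAddCommGroup J] [NormedSpace ℝ J] [FiniteDimensional ℝ J]
  {mul : J →ₗ[ℝ] J →ₗ[ℝ] J} {hJ : IsJordan mul}

/-- `ĝ(J)` as a pair, used to transport the vector space structure of `Der₀(J) × J`. -/
def equivProd : ExtAlgebra hJ ≃ innerDer mul × J where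
  toFun X := (X.der, X.elt)
  invFun p := ⟨p.1, p.2⟩

instance : AddCommGroup (ExtAlgebra hJ) := equivProd.addCommGroup

instance : Module ℝ (ExtAlgebra hJ) := equivProd.module ℝ

/-- The bracket `[d + x, e + y] = ([d, e] + [l_x, l_y]) + (d y - e x)`. -/
instance : Bracket (ExtAlgebra hJ) (ExtAlgebra hJ) where
  bracket X Y :=
    { der := ⟨⁅(X.der : J →L[ℝ] J), (Y.der : J →L[ℝ] J)⁆ + ⁅lmul mul X.elt, lmul mul Y.elt⁆,
        add_mem (innerDer_lie_mem hJ X.der.2 Y.der.2) (lie_lmul_mem mul X.elt Y.elt)⟩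
      elt := X.der.1 Y.elt - Y.der.1 X.elt }

@[simp] theorem bracket_der (X Y : ExtAlgebra hJ) :
    ((⁅X, Y⁆ : ExtAlgebra hJ).der : J →L[ℝ] J) =
      ⁅(X.der : J →L[ℝ] J), (Y.der : J →L[ℝ] J)⁆ + ⁅lmul mul X.elt, lmul mul Y.elt⁆ := rfl

@[simp] theorem bracket_elt (X Y : ExtAlgebra hJ) :
    (⁅X, Y⁆ : ExtAlgebra hJ).elt = X.der.1 Y.elt - Y.der.1 X.elt := rfl

@[simp] theorem add_der (X Y : ExtAlgebra hJ) : (X + Y).der = X.der + Y.der := rfl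

@[simp] theorem add_elt (X Y : ExtAlgebra hJ) : (X + Y).elt = X.elt + Y.elt := rfl

@[simp] theorem smul_der (c : ℝ) (X : ExtAlgebra hJ) : (c • X).der = c • X.der := rfl

@[simp] theorem smul_elt (c : ℝ) (X : ExtAlgebra hJ) : (c • X).elt = c • X.elt := rfl

@[simp] theorem zero_der : (0 : ExtAlgebra hJ).der = 0 := rfl

@[simp] theorem zero_elt : (0 : ExtAlgebra hJ).elt = 0 := rfl

instance : LieRing (ExtAlgebra hJ) where
  add_lie X Y Z := by
    ext1
    · apply Subtype.ext; simp; abel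
    · simp; abel
  lie_add X Y Z := by
    ext1
    · apply Subtype.ext; simp; abel
    · simp; abel
  lie_self X := by
    ext1
    · apply Subtype.ext; simp
    · simp
  leibniz_lie X Y Z := by
    ext1
    · apply Subtype.ext
      simp only [bracket_der, bracket_elt, add_der, Submodule.coe_add, lie_add, add_lie, map_sub,
        lie_sub, sub_lie, ← innerDer_lie_lmul hJ X.der.2, ← innerDer_lie_lmul hJ Y.der.2,
        ← innerDer_lie_lmul hJ Z.der.2]
      simp only [Ring.lie_def]
      noncomm_ring
    · simp only [bracket_der, bracket_elt, add_elt, map_sub, add_apply, lie_apply, lmul_apply]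
      rw [hJ.comm Z.elt X.elt, hJ.comm Y.elt X.elt, hJ.comm Z.elt Y.elt]
      abel

instance : LieAlgebra ℝ (ExtAlgebra hJ) where
  lie_smul c X Y := by
    ext1
    · apply Subtype.ext; simp
    · simp [smul_sub]

variable (hJ)

/-- The standard representation `φ : ĝ(J) → gl(J)`, `φ(d) = d`, `φ(x) = l_x`. -/
def standardRep : ExtAlgebra hJ →ₗ⁅ℝ⁆ (J →L[ℝ] J) where
  toFun X := (X.der : J →L[ℝ] J) + lmul mul X.elt
  map_add' X Y := by simp; abel
  map_smul' c X := by simp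
  map_lie' {X Y} := by
    simp only [bracket_der, bracket_elt, map_sub, lie_add, add_lie,
      ← innerDer_lie_lmul hJ X.der.2, ← innerDer_lie_lmul hJ Y.der.2]
    simp only [Ring.lie_def]
    abel

/-- The subspace `Der₀(J) ⊆ ĝ(J)`. -/
def derPart : Submodule ℝ (ExtAlgebra hJ) where
  carrier := {X | X.elt = 0}
  add_mem' := fun {X Y} hX hY => by
    simp only [Set.mem_ofPred_eq] at hX hY ⊢
    simp [hX, hY]
  zero_mem' := rfl
  smul_mem' := fun c X hX => by
    simp only [Set.mem_ofPred_eq] at hX ⊢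
    simp [hX]

/-- The subspace `J ⊆ ĝ(J)`. -/
def jordanPart : Submodule ℝ (ExtAlgebra hJ) where
  carrier := {X | X.der = 0}
  add_mem' := fun {X Y} hX hY => by
    simp only [Set.mem_ofPred_eq] at hX hY ⊢
    simp [hX, hY]
  zero_mem' := rfl
  smul_mem' := fun c X hX => by
    simp only [Set.mem_ofPred_eq] at hX ⊢
    simp [hX]

/-- `V · ξ = {X · ξ | X ∈ V} ⊆ J*` for a subspace `V ⊆ ĝ(J)` and the dual action of `ĝ(J)`,
`X · ξ = -ξ ∘ φ(X)`. -/
def act (V : Submodule ℝ (ExtAlgebra hJ)) (ξ : StrongDual ℝ J) :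
    Submodule ℝ (StrongDual ℝ J) :=
  V.map (dualAct ξ ∘ₗ (standardRep hJ : ExtAlgebra hJ →ₗ[ℝ] (J →L[ℝ] J)))

end ExtAlgebra

end

end JordanDist

/-! Write `L` for g(J). By the Jordan identity, `L` = Der₀(J) + m_J, so condition 3 says exactly
that m_J · ξ = `L` · ξ, i.e. that ξ is a regular point of its orbit. Involutivity at ξ gives
condition 3 by bracketing the linear fields η ↦ η ∘ l_x, whose brackets are the fields of Der₀(J).
An integral leaf gives involutivity because brackets of fields tangent to a submanifold are tangent
to it. What remains is to build a leaf at a regular point and to compare it with all others.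

For this, J* gets a leaf topology: a set is open if with η it contains exp X · η for all small X in
`L`. A plaque is a local immersion with tangent spaces `L` · η. Plaques exist through every point,
as products of one-parameter groups (`exists_plaque`). By a Gronwall estimate, exp X with X in `L`
maps plaques into themselves locally (`IsPlaque.eventually_expUnit_act`), so plaques are local
homeomorphisms into the leaf space (`IsPlaque.map_nhds`). Hence orbits are clopen there, carry their
homogeneous topology, and connected sets are second countable.

Regularity is open in the leaf topology, so the component C of ξ in the regular part is open and is
an integral leaf. Conversely every point of a leaf of H^J is integrable, hence regular. The leaf
therefore has tangent spaces `L` · η and embeds as an open set; if it is connected and contains ξ,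
it lies in C. This makes C maximal (`maximalLeaf_of_regular`). -/

namespace JordanDist

noncomputable section

attribute [local instance] LieRing.ofAssociativeRing

/-! ### One-parameter groups in the dual representation -/

section ExpAction

variable {A : Type u} [NormedAddCommGroup A] [NormedSpace ℝ A]

theorem dualGroupAct_one (η : StrongDual ℝ A) : dualGroupAct 1 η = η := by
  ext; simp [dualGroupAct]

theorem dualGroupAct_mul (g h : (A →L[ℝ] A)ˣ) (η : StrongDual ℝ A) :
    dualGroupAct (g * h) η = dualGroupAct g (dualGroupAct h η) := by
  ext; simp [dualGroupAct]

theorem dualGroupAct_inv_dualGroupAct (g : (A →L[ℝ] A)ˣ) (η : StrongDual ℝ A) :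
    dualGroupAct g⁻¹ (dualGroupAct g η) = η := by
  rw [← dualGroupAct_mul, inv_mul_cancel, dualGroupAct_one]

theorem dualGroupAct_dualGroupAct_inv (g : (A →L[ℝ] A)ˣ) (η : StrongDual ℝ A) :
    dualGroupAct g (dualGroupAct g⁻¹ η) = η := by
  rw [← dualGroupAct_mul, mul_inv_cancel, dualGroupAct_one]

/-- The dual representation of a group element, as a continuous linear equivalence. -/
def dualGroupEquiv (g : (A →L[ℝ] A)ˣ) : StrongDual ℝ A ≃L[ℝ] StrongDual ℝ A where
  toFun := dualGroupAct g
  invFun := dualGroupAct g⁻¹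
  map_add' η θ := by ext; simp [dualGroupAct]
  map_smul' c η := by ext; simp [dualGroupAct]
  left_inv := dualGroupAct_inv_dualGroupAct g
  right_inv := dualGroupAct_dualGroupAct_inv g
  continuous_toFun := (continuous_id.clm_comp continuous_const :
    Continuous fun η : StrongDual ℝ A => η.comp ((g⁻¹ : (A →L[ℝ] A)ˣ) : A →L[ℝ] A))
  continuous_invFun := (continuous_id.clm_comp continuous_const :
    Continuous fun η : StrongDual ℝ A => η.comp ((g⁻¹⁻¹ : (A →L[ℝ] A)ˣ) : A →L[ℝ] A))

@[simp]
theorem dualGroupEquiv_apply (g : (A →L[ℝ] A)ˣ) (η : StrongDual ℝ A) :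
    dualGroupEquiv g η = dualGroupAct g η := rfl

theorem dualAct_apply (η : StrongDual ℝ A) (X : A →L[ℝ] A) : dualAct η X = -(η.comp X) := rfl

theorem dualAct_dualGroupAct (g : (A →L[ℝ] A)ˣ) (η : StrongDual ℝ A) (X : A →L[ℝ] A) :
    dualAct (dualGroupAct g η) ((g : A →L[ℝ] A) * X * (g⁻¹ : (A →L[ℝ] A)ˣ)) =
      dualGroupAct g (dualAct η X) := by
  have h : ∀ x, ((g⁻¹ : (A →L[ℝ] A)ˣ) : A →L[ℝ] A) ((g : A →L[ℝ] A) x) = x := fun x => by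
    
    change (((g⁻¹ : (A →L[ℝ] A)ˣ) : A →L[ℝ] A) * (g : A →L[ℝ] A)) x = x
    rw [← Units.val_mul, inv_mul_cancel]; rfl
  ext x
  simp [dualAct_apply, dualGroupAct, h]

variable (A) in
/-- The dual action of `gl(A)` on `A*`, `η ↦ (X ↦ -η ∘ X)`, as a continuous linear map. -/
def dualActL : StrongDual ℝ A →L[ℝ] (A →L[ℝ] A) →L[ℝ] StrongDual ℝ A :=
  -(ContinuousLinearMap.compL ℝ A A ℝ)

@[simp]
theorem dualActL_apply (η : StrongDual ℝ A) (X : A →L[ℝ] A) : dualActL A η X = dualAct η X := rfl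

variable [FiniteDimensional ℝ A]

theorem expUnit_zero : expUnit (0 : A →L[ℝ] A) = 1 := by
  ext1; simp [NormedSpace.exp_zero]

theorem expUnit_add {X Y : A →L[ℝ] A} (h : Commute X Y) :
    expUnit (X + Y) = expUnit X * expUnit Y := by
  let _ : CompleteSpace A := FiniteDimensional.complete ℝ A
  let _ : NormedAlgebra ℚ (A →L[ℝ] A) := NormedAlgebra.restrictScalars ℚ ℝ (A →L[ℝ] A)
  ext1
  simp [NormedSpace.exp_add_of_commute h]

theorem expUnit_neg (X : A →L[ℝ] A) : expUnit (-X) = (expUnit X)⁻¹ := by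
  rw [eq_inv_iff_mul_eq_one, ← expUnit_add ((Commute.refl X).neg_left), neg_add_cancel, expUnit_zero]

theorem expUnit_conj (g : (A →L[ℝ] A)ˣ) (X : A →L[ℝ] A) :
    expUnit ((g : A →L[ℝ] A) * X * ((g⁻¹ : (A →L[ℝ] A)ˣ) : A →L[ℝ] A)) = g * expUnit X * g⁻¹ := by
  let _ : CompleteSpace A := FiniteDimensional.complete ℝ A
  let _ : NormedAlgebra ℚ (A →L[ℝ] A) := NormedAlgebra.restrictScalars ℚ ℝ (A →L[ℝ] A)
  ext1
  simp [NormedSpace.exp_units_conj]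

theorem dualGroupAct_expUnit (X : A →L[ℝ] A) (η : StrongDual ℝ A) :
    dualGroupAct (expUnit X) η = η.comp (NormedSpace.exp (-X)) := by
  rw [dualGroupAct, ← expUnit_neg, coe_expUnit]

theorem contDiff_exp : ContDiff ℝ ∞ (NormedSpace.exp : (A →L[ℝ] A) → (A →L[ℝ] A)) := by
  let _ : CompleteSpace A := FiniteDimensional.complete ℝ A
  exact contDiff_iff_contDiffAt.2 fun X => (NormedSpace.exp_analytic (𝕂 := ℝ) X).contDiffAt

/-- The action `(X, η) ↦ exp X · η` is smooth. -/
theorem contDiff_expUnit_act :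
    ContDiff ℝ ∞ fun p : (A →L[ℝ] A) × StrongDual ℝ A => dualGroupAct (expUnit p.1) p.2 := by
  simp only [dualGroupAct_expUnit]
  exact contDiff_snd.clm_comp (contDiff_exp.comp contDiff_fst.neg)

theorem hasDerivAt_expUnit_act (X : A →L[ℝ] A) (η : StrongDual ℝ A) (t : ℝ) :
    HasDerivAt (fun s : ℝ => dualGroupAct (expUnit (s • X)) η)
      (dualAct (dualGroupAct (expUnit (t • X)) η) X) t := by
  let _ : CompleteSpace A := FiniteDimensional.complete ℝ A
  have h1 := hasDerivAt_exp_smul_const (𝕂 := ℝ) (-X) t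
  have h2 := (ContinuousLinearMap.compL ℝ A A ℝ η).hasFDerivAt.comp_hasDerivAt t h1
  have e1 : (fun s : ℝ => dualGroupAct (expUnit (s • X)) η) =
      fun s : ℝ => η.comp (NormedSpace.exp (s • (-X))) := by
    ext1 s; rw [dualGroupAct_expUnit, smul_neg]
  have e2 : dualAct (dualGroupAct (expUnit (t • X)) η) X =
      η.comp (NormedSpace.exp (t • (-X)) * (-X)) := by
    rw [dualGroupAct_expUnit, smul_neg]; ext a; simp [dualAct_apply]
  rw [e1, e2]
  exact h2

theorem hasStrictFDerivAt_expUnit_act_zero (η : StrongDual ℝ A) :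
    HasStrictFDerivAt (fun X : A →L[ℝ] A => dualGroupAct (expUnit X) η) (dualActL A η) 0 := by
  let _ : CompleteSpace A := FiniteDimensional.complete ℝ A
  have h0 : HasStrictFDerivAt (NormedSpace.exp : (A →L[ℝ] A) → (A →L[ℝ] A))
      (1 : (A →L[ℝ] A) →L[ℝ] (A →L[ℝ] A)) (-0) := by
    rw [neg_zero]; exact hasStrictFDerivAt_exp_zero
  have h1 := h0.comp (0 : A →L[ℝ] A) (hasStrictFDerivAt_id (𝕜 := ℝ) (0 : A →L[ℝ] A)).fun_neg
  have h2 := (ContinuousLinearMap.compL ℝ A A ℝ η).hasStrictFDerivAt.comp 0 h1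
  simp only [dualGroupAct_expUnit]
  have e : dualActL A η = (ContinuousLinearMap.compL ℝ A A ℝ η) ∘SL
      ((1 : (A →L[ℝ] A) →L[ℝ] (A →L[ℝ] A)) ∘SL (-ContinuousLinearMap.id ℝ (A →L[ℝ] A))) := by
    ext X a; simp [dualAct_apply]
  rw [e]
  exact h2

/-- The curve f(t) = exp(tX) Y exp(-tX) solves f' = [X, f], and ad X preserves `L`. So the component
of f transverse to `L` solves a linear equation with zero initial value and vanishes. -/
theorem exp_lie_mem {L : LieSubalgebra ℝ (A →L[ℝ] A)} {X Y : A →L[ℝ] A} (hX : X ∈ L) (hY : Y ∈ L) :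
    (expUnit X : A →L[ℝ] A) * Y * ((expUnit X)⁻¹ : (A →L[ℝ] A)ˣ) ∈ L := by
  let _ : CompleteSpace A := FiniteDimensional.complete ℝ A
  set f : ℝ → (A →L[ℝ] A) := fun t =>
    NormedSpace.exp (t • X) * Y * NormedSpace.exp (t • (-X)) with hf
  have hd : ∀ t, HasDerivAt f (X * f t - f t * X) t := by
    intro t
    have h1 := hasDerivAt_exp_smul_const' (𝕂 := ℝ) X t
    have h2 := hasDerivAt_exp_smul_const (𝕂 := ℝ) (-X) t
    have h3 := (h1.mul_const Y).mul h2
    refine h3.congr_deriv ?_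
    simp only [hf]
    noncomm_ring
  obtain ⟨p, hp⟩ := Submodule.ClosedComplemented.of_finiteDimensional L.toSubmodule
  -- `q` is a projection with kernel `L`. Since ad X preserves this kernel, `q ∘ f` satisfies a
  -- closed linear equation.
  set q : (A →L[ℝ] A) →L[ℝ] (A →L[ℝ] A) :=
    ContinuousLinearMap.id ℝ _ - L.toSubmodule.subtypeL ∘SL p with hq
  have hq0 : ∀ Z ∈ L, q Z = 0 := fun Z hZ => by
    simp [hq, hp ⟨Z, hZ⟩]
  have hqL : ∀ Z, Z - q Z ∈ L := fun Z => by
    have : Z - q Z = (p Z : A →L[ℝ] A) := by simp [hq]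
    rw [this]; exact (p Z).2
  set ad : (A →L[ℝ] A) →L[ℝ] (A →L[ℝ] A) :=
    ContinuousLinearMap.mul ℝ _ X - (ContinuousLinearMap.mul ℝ (A →L[ℝ] A)).flip X with had
  have hqad : ∀ Z, q (ad Z) = q (ad (q Z)) := fun Z => by
    rw [← sub_eq_zero, ← map_sub, ← map_sub]
    apply hq0
    have := L.lie_mem hX (hqL Z)
    rwa [Ring.lie_def] at this
  have hd' : ∀ t, HasDerivAt (fun t => q (f t)) ((q ∘SL ad) (q (f t))) t := fun t =>
    (q.hasFDerivAt.comp_hasDerivAt t (hd t)).congr_deriv (hqad (f t))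
  have h0 := eq_zero_of_abs_deriv_le_mul_abs_self_of_eq_zero_right
    (f := fun t => q (f t)) (a := 0) (b := 1) (K := ‖q ∘SL ad‖)
    (fun t _ => (hd' t).continuousAt.continuousWithinAt) (fun t _ => (hd' t).hasDerivWithinAt)
    (hq0 _ (by simpa [hf, NormedSpace.exp_zero] using hY))
    (fun t _ => (q ∘SL ad).le_opNorm _) 1 (by simp)
  have h1 := hqL (f 1)
  rw [h0, sub_zero] at h1
  simpa [hf, ← expUnit_neg] using h1

/-- The subgroup generated by `exp L`. -/
def expGroup (L : LieSubalgebra ℝ (A →L[ℝ] A)) : Subgroup (A →L[ℝ] A)ˣ :=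
  Subgroup.closure (expUnit '' (L : Set (A →L[ℝ] A)))

theorem expUnit_mem {L : LieSubalgebra ℝ (A →L[ℝ] A)} {X : A →L[ℝ] A} (hX : X ∈ L) :
    expUnit X ∈ expGroup L :=
  Subgroup.subset_closure ⟨X, hX, rfl⟩

theorem conj_mem {L : LieSubalgebra ℝ (A →L[ℝ] A)} {g : (A →L[ℝ] A)ˣ} (hg : g ∈ expGroup L) :
    ∀ {Y : A →L[ℝ] A}, Y ∈ L → (g : A →L[ℝ] A) * Y * (g⁻¹ : (A →L[ℝ] A)ˣ) ∈ L := by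
  induction hg using Subgroup.closure_induction'' with
  | mem x hx =>
    obtain ⟨X, hX, rfl⟩ := hx
    exact fun hY => exp_lie_mem hX hY
  | inv_mem x hx =>
    obtain ⟨X, hX, rfl⟩ := hx
    rw [← expUnit_neg]
    exact fun hY => exp_lie_mem (L.neg_mem hX) hY
  | one => intro Y hY; simpa using hY
  | mul x y _ _ hx hy =>
    intro Y hY
    have := hx (hy hY)
    simpa [mul_assoc] using this

/-- Equivariance, because Ad g preserves `L`. In particular the rank of η ↦ `L` · η is constant on
orbits, which replaces the constant-rank hypothesis of the Frobenius theorem. -/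
theorem orbitDistribution_dualGroupAct {L : LieSubalgebra ℝ (A →L[ℝ] A)} {g : (A →L[ℝ] A)ˣ}
    (hg : g ∈ expGroup L) (η : StrongDual ℝ A) :
    orbitDistribution L.toSubmodule (dualGroupAct g η) =
      (orbitDistribution L.toSubmodule η).map
        ((dualGroupEquiv g).toLinearEquiv : StrongDual ℝ A →ₗ[ℝ] StrongDual ℝ A) := by
  apply le_antisymm
  · rintro _ ⟨X, hX, rfl⟩
    refine ⟨_, ⟨_, conj_mem (inv_mem hg) hX, rfl⟩, ?_⟩
    have := dualAct_dualGroupAct g η (((g⁻¹ : (A →L[ℝ] A)ˣ) : A →L[ℝ] A) * X * (g⁻¹⁻¹ : (A →L[ℝ] A)ˣ))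
    refine this.symm.trans ?_
    congr 1
    simp [← mul_assoc]
  · rintro _ ⟨_, ⟨X, hX, rfl⟩, rfl⟩
    exact ⟨_, conj_mem hg hX, dualAct_dualGroupAct g η X⟩

theorem finrank_orbitDistribution_dualGroupAct {L : LieSubalgebra ℝ (A →L[ℝ] A)}
    {g : (A →L[ℝ] A)ˣ} (hg : g ∈ expGroup L) (η : StrongDual ℝ A) :
    Module.finrank ℝ (orbitDistribution L.toSubmodule (dualGroupAct g η)) =
      Module.finrank ℝ (orbitDistribution L.toSubmodule η) := by
  rw [orbitDistribution_dualGroupAct hg]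
  exact LinearEquiv.finrank_map_eq _ _

end ExpAction

/-! ### Parametrized integral manifolds -/

section PlaqueDef

variable {E V : Type*} [NormedAddCommGroup E] [NormedSpace ℝ E]
  [NormedAddCommGroup V] [NormedSpace ℝ V]

/-- `F` parametrizes, on the open set `U`, an integral manifold of the family of subspaces `D`. -/
structure IsPlaque (D : V → Submodule ℝ V) (F : E → V) (U : Set E) : Prop where
  isOpen : IsOpen U
  contDiffAt : ∀ b ∈ U, ContDiffAt ℝ ∞ F b
  injective : ∀ b ∈ U, Function.Injective (fderiv ℝ F b)
  range_eq : ∀ b ∈ U, LinearMap.range (fderiv ℝ F b).toLinearMap = D (F b)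

variable {D : V → Submodule ℝ V} {F : E → V} {U : Set E}

theorem IsPlaque.mono (hF : IsPlaque D F U) {W : Set E} (hW : IsOpen W) (hWU : W ⊆ U) :
    IsPlaque D F W :=
  ⟨hW, fun b hb => hF.contDiffAt b (hWU hb), fun b hb => hF.injective b (hWU hb),
    fun b hb => hF.range_eq b (hWU hb)⟩

theorem IsPlaque.congr {G : E → V} (hF : IsPlaque D F U)
    (h : Set.EqOn F G U) : IsPlaque D G U := by
  have he : ∀ b ∈ U, G =ᶠ[𝓝 b] F := fun b hb =>
    Filter.eventuallyEq_of_mem (hF.isOpen.mem_nhds hb) fun x hx => (h hx).symm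
  refine ⟨hF.isOpen, fun b hb => (hF.contDiffAt b hb).congr_of_eventuallyEq (he b hb),
    fun b hb => ?_, fun b hb => ?_⟩
  · rw [(he b hb).fderiv_eq]; exact hF.injective b hb
  · rw [(he b hb).fderiv_eq, hF.range_eq b hb, h hb]

end PlaqueDef

/-! ### Local left inverses and brackets of tangent fields -/

section Plaque

variable {E V : Type*} [NormedAddCommGroup E] [NormedSpace ℝ E] [FiniteDimensional ℝ E]
  [NormedAddCommGroup V] [NormedSpace ℝ V] [FiniteDimensional ℝ V]

/-- An immersion has smooth local left inverses. -/
theorem exists_local_leftInverse {F : E → V} {b : E} (hF : ContDiffAt ℝ ∞ F b)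
    (hinj : Function.Injective (fderiv ℝ F b)) :
    ∃ r : V → E, ContDiffAt ℝ ∞ r (F b) ∧ ∀ᶠ x in 𝓝 b, r (F x) = x := by
  let _ : CompleteSpace E := FiniteDimensional.complete ℝ E
  obtain ⟨p, hp⟩ := (fderiv ℝ F b).toLinearMap.exists_leftInverse_of_injective
    (LinearMap.ker_eq_bot.2 hinj)
  set P : V →L[ℝ] E := LinearMap.toContinuousLinearMap p with hP
  have hg : ContDiffAt ℝ ∞ (P ∘ F) b := P.contDiff.contDiffAt.comp b hF
  have hd : HasFDerivAt (P ∘ F) ((ContinuousLinearEquiv.refl ℝ E : E ≃L[ℝ] E) : E →L[ℝ] E) b := by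
    refine (P.hasFDerivAt.comp b (hF.differentiableAt (by simp)).hasFDerivAt).congr_fderiv ?_
    ext v
    exact LinearMap.congr_fun hp v
  have hs := hg.hasStrictFDerivAt' hd (by simp)
  refine ⟨hg.localInverse hd (by simp) ∘ P, ?_, ?_⟩
  · exact (hg.to_localInverse hd (by simp)).comp (F b) P.contDiff.contDiffAt
  · exact hs.eventually_left_inverse

variable {D : V → Submodule ℝ V} {F : E → V} {U : Set E}

/-- The bracket of two vector fields tangent to an integral manifold is tangent to it. -/
theorem IsPlaque.lieBracket_mem (hF : IsPlaque D F U) {b : E} (hb : b ∈ U) {X Y : V → V}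
    (hX : IsSection D X) (hY : IsSection D Y) : VectorField.lieBracket ℝ X Y (F b) ∈ D (F b) := by
  obtain ⟨r, hr, hrF⟩ := exists_local_leftInverse (hF.contDiffAt b hb) (hF.injective b hb)
  have hrb : r (F b) = b := hrF.self_of_nhds
  have hev : ∀ᶠ x in 𝓝 b, x ∈ U ∧ (∀ᶠ y in 𝓝 x, r (F y) = y) ∧ DifferentiableAt ℝ r (F x) := by
    have h1 : ∀ᶠ η in 𝓝 (F b), ContDiffAt ℝ 1 r η :=
      (hr.of_le (by exact_mod_cast le_top)).eventually (by decide)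
    filter_upwards [hF.isOpen.mem_nhds hb, hrF.eventually_nhds,
      (hF.contDiffAt b hb).continuousAt.eventually h1] with x h1 h2 h3
    exact ⟨h1, h2, h3.differentiableAt (by simp)⟩
  -- vector fields on the parameter space
  have key : ∀ Z : V → V, IsSection D Z → ∀ᶠ x in 𝓝 b,
      fderiv ℝ F x (fderiv ℝ r (F x) (Z (F x))) = Z (F x) := by
    intro Z hZ
    filter_upwards [hev] with x hx
    have h1 := hZ.2 (F x)
    rw [← hF.range_eq x hx.1] at h1
    obtain ⟨v, hv⟩ := h1
    have hc : HasFDerivAt (r ∘ F) (ContinuousLinearMap.id ℝ E) x :=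
      (hasFDerivAt_id x).congr_of_eventuallyEq hx.2.1
    have h2 := (hx.2.2.hasFDerivAt.comp x
      ((hF.contDiffAt x hx.1).differentiableAt (by simp)).hasFDerivAt).unique hc
    have h3 : fderiv ℝ r (F x) (fderiv ℝ F x v) = v := DFunLike.congr_fun h2 v
    change fderiv ℝ F x v = _ at hv
    rw [← hv, h3]
  have hFd := (hF.contDiffAt b hb).differentiableAt (by simp)
  have hdiff : ∀ Z : V → V, IsSection D Z →
      DifferentiableAt ℝ (fun x => fderiv ℝ r (F x) (Z (F x))) b := by
    intro Z hZ
    have h1 : DifferentiableAt ℝ (fderiv ℝ r) (F b) :=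
      (hr.fderiv_right (m := 1) (by decide)).differentiableAt (by simp)
    exact (h1.comp b hFd).clm_apply ((hZ.1.differentiable (by simp) (F b)).comp b hFd)
  -- The second derivatives of `F` cancel by symmetry, so DF sends the bracket of the lifts to the
  -- bracket of the original fields.
  have hmain := VectorField.fderiv_apply_lieBracket (𝕜 := ℝ) (n := ∞) (f := F) (x := b)
    (hF.contDiffAt b hb) (by simp; decide) (hdiff Y hY) (hdiff X hX)
  rw [Filter.EventuallyEq.fderiv_eq (key X hX), Filter.EventuallyEq.fderiv_eq (key Y hY)] at hmain
  rw [← hF.range_eq b hb]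
  refine ⟨_, hmain.trans ?_⟩
  rw [fderiv_fun_comp b (hY.1.differentiable (by simp) (F b)) hFd,
    fderiv_fun_comp b (hX.1.differentiable (by simp) (F b)) hFd]
  simp only [ContinuousLinearMap.comp_apply, VectorField.lieBracket]
  rw [(key X hX).self_of_nhds, (key Y hY).self_of_nhds]

end Plaque

/-! ### Local invariance of integral manifolds under the group -/

section Flow

variable {E : Type*} [NormedAddCommGroup E] [NormedSpace ℝ E]
  {A : Type u} [NormedAddCommGroup A] [NormedSpace ℝ A] [FiniteDimensional ℝ A]
  {L : Submodule ℝ (A →L[ℝ] A)} {F : E → StrongDual ℝ A} {U : Set E} {b₀ : E}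
  {r : StrongDual ℝ A → E}

/-- The one-parameter groups `exp (tX)`, `X ∈ L`, preserve the integral manifolds of `L · η`
locally: the distance of the flow line to the manifold satisfies a Gronwall inequality. -/
theorem IsPlaque.eventually_expUnit_act (hF : IsPlaque (orbitDistribution L) F U) (hb : b₀ ∈ U)
    (hr : ContDiffAt ℝ ∞ r (F b₀)) (hrF : ∀ᶠ x in 𝓝 b₀, r (F x) = x) :
    ∀ᶠ p : (A →L[ℝ] A) × E in 𝓝[L] 0 ×ˢ 𝓝 b₀,
      F (r (dualGroupAct (expUnit p.1) (F p.2))) = dualGroupAct (expUnit p.1) (F p.2) := by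
  have hFc := hF.contDiffAt b₀ hb
  have hrb : r (F b₀) = b₀ := hrF.self_of_nhds
  have hFc' : ContDiffAt ℝ ∞ F (r (F b₀)) := by rwa [hrb]
  -- `Z η X` is the derivative of η - F(r η), the displacement from the plaque, in the direction X ·
  -- η. It is C¹ in η, hence locally Lipschitz.
  set Z : StrongDual ℝ A → ((A →L[ℝ] A) →L[ℝ] StrongDual ℝ A) := fun η =>
    dualActL A η - (fderiv ℝ F (r η)).comp ((fderiv ℝ r η).comp (dualActL A η)) with hZ
  have hZc : ContDiffAt ℝ 1 Z (F b₀) := by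
    have h1 : ContDiffAt ℝ 1 (fderiv ℝ F) (r (F b₀)) := hFc'.fderiv_right (by decide)
    have h2 : ContDiffAt ℝ 1 (fderiv ℝ r) (F b₀) := hr.fderiv_right (by decide)
    have h3 : ContDiffAt ℝ 1 r (F b₀) := hr.of_le (by exact_mod_cast le_top)
    have h4 : ContDiffAt ℝ 1 (fun η => dualActL A η) (F b₀) := by
      exact (ContinuousLinearMap.contDiff (𝕜 := ℝ) (E := StrongDual ℝ A)
        (F := (A →L[ℝ] A) →L[ℝ] StrongDual ℝ A) (dualActL A)).contDiffAt
    exact h4.sub ((h1.comp (F b₀) h3).clm_comp (h2.clm_comp h4))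
  obtain ⟨K, s, hs, hlip⟩ := hZc.exists_lipschitzOnWith
  have hρ : Filter.Tendsto (fun η => F (r η)) (𝓝 (F b₀)) (𝓝 (F b₀)) := by
    have := hFc'.continuousAt.comp (f := r) hr.continuousAt
    simpa [ContinuousAt, hrb, Function.comp_def] using this
  have hrt : Filter.Tendsto r (𝓝 (F b₀)) (𝓝 b₀) := by
    simpa [ContinuousAt, hrb] using hr.continuousAt
  have hrd : ∀ᶠ η in 𝓝 (F b₀), DifferentiableAt ℝ r η := by
    have h1 : ∀ᶠ η in 𝓝 (F b₀), ContDiffAt ℝ 1 r η :=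
      (hr.of_le (by exact_mod_cast le_top)).eventually (by decide)
    exact h1.mono fun η h => h.differentiableAt (by simp)
  have hgood : ∀ᶠ η in 𝓝 (F b₀), η ∈ s ∧ F (r η) ∈ s ∧ r η ∈ U ∧
      (∀ᶠ x in 𝓝 (r η), r (F x) = x) ∧ DifferentiableAt ℝ r η ∧
        DifferentiableAt ℝ r (F (r η)) := by
    filter_upwards [hs, hρ hs, hrt (hF.isOpen.mem_nhds hb), hrt.eventually hrF.eventually_nhds,
      hrd, hρ.eventually hrd] with η h1 h2 h3 h4 h5 h6
    exact ⟨h1, h2, h3, h4, h5, h6⟩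
  -- on the integral manifold `Z` vanishes on `L`
  have hZ0 : ∀ η, r η ∈ U → (∀ᶠ x in 𝓝 (r η), r (F x) = x) → DifferentiableAt ℝ r (F (r η)) →
      ∀ X ∈ L, Z (F (r η)) X = 0 := by
    intro η hU hx hd X hX
    have h1 : dualAct (F (r η)) X ∈ orbitDistribution L (F (r η)) := ⟨X, hX, rfl⟩
    rw [← hF.range_eq _ hU] at h1
    obtain ⟨v, hv⟩ := h1
    have hc : HasFDerivAt (r ∘ F) (ContinuousLinearMap.id ℝ E) (r η) :=
      (hasFDerivAt_id _).congr_of_eventuallyEq hx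
    have h2 := (hd.hasFDerivAt.comp (r η)
      ((hF.contDiffAt _ hU).differentiableAt (by simp)).hasFDerivAt).unique hc
    have h3 : fderiv ℝ r (F (r η)) (fderiv ℝ F (r η) v) = v := DFunLike.congr_fun h2 v
    change fderiv ℝ F (r η) v = _ at hv
    simp only [hZ, sub_apply, dualActL_apply, ContinuousLinearMap.comp_apply]
    rw [hx.self_of_nhds, ← hv, h3, sub_self]
  have hcont : ContinuousAt (fun p : (A →L[ℝ] A) × E => dualGroupAct (expUnit p.1) (F p.2))
      (0, b₀) := by
    have h1 : ContinuousAt (fun p : (A →L[ℝ] A) × E => (p.1, F p.2)) (0, b₀) :=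
      continuousAt_fst.prodMk (hFc.continuousAt.comp (f := Prod.snd) (x := ((0 : A →L[ℝ] A), b₀))
        continuousAt_snd)
    exact (contDiff_expUnit_act.continuous.continuousAt (x := ((0 : A →L[ℝ] A), F b₀))).comp
      (f := fun p : (A →L[ℝ] A) × E => (p.1, F p.2)) (x := (0, b₀)) h1
  have hgood' := hgood
  rw [← dualGroupAct_one (F b₀), ← expUnit_zero] at hgood'
  have hev := hcont.eventually hgood'
  rw [nhds_prod_eq] at hev
  obtain ⟨pa, hpa, pb, hpb, hab⟩ := Filter.eventually_prod_iff.1 hev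
  obtain ⟨δ, hδ, hball⟩ := Metric.eventually_nhds_iff_ball.1 hpa
  have hLev : ∀ᶠ X in 𝓝[L] (0 : A →L[ℝ] A), X ∈ Metric.ball (0 : A →L[ℝ] A) δ ∧ X ∈ L := by
    filter_upwards [self_mem_nhdsWithin, mem_nhdsWithin_of_mem_nhds (Metric.ball_mem_nhds _ hδ)]
      with X h1 h2 using ⟨h2, h1⟩
  filter_upwards [hLev.prod_mk (hpb.and hrF)]
  rintro ⟨X, b⟩ ⟨⟨hXδ, hXL⟩, hb', hrFb⟩
  set c : ℝ → StrongDual ℝ A := fun t => dualGroupAct (expUnit (t • X)) (F b) with hc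
  -- The ball is star-shaped about 0, so the whole segment tX stays in the range of validity and the
  -- estimate is uniform in the starting point.
  have hcgood : ∀ t ∈ Set.Icc (0 : ℝ) 1, _ := fun t ht =>
    hab (hball (t • X) (by
      rw [mem_ball_zero_iff, norm_smul, Real.norm_of_nonneg ht.1]
      exact (mul_le_of_le_one_left (norm_nonneg X) ht.2).trans_lt (mem_ball_zero_iff.1 hXδ))) hb'
  have hder : ∀ t ∈ Set.Icc (0 : ℝ) 1, HasDerivAt (fun t => c t - F (r (c t))) (Z (c t) X) t := by
    intro t ht
    obtain ⟨-, -, h3, -, h5, -⟩ := hcgood t ht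
    have h1 : HasDerivAt c (dualAct (c t) X) t := hasDerivAt_expUnit_act X (F b) t
    have h2 := h5.hasFDerivAt.comp_hasDerivAt t h1
    exact h1.sub ((((hF.contDiffAt _ h3).differentiableAt (by simp)).hasFDerivAt).comp_hasDerivAt
      t h2)
  -- Gronwall: `Z` vanishes on `L` at F(r(c t)), so the Lipschitz bound controls the derivative of
  -- the displacement by the displacement itself, which starts at 0.
  have hzero := eq_zero_of_abs_deriv_le_mul_abs_self_of_eq_zero_right
    (f := fun t => c t - F (r (c t))) (f' := fun t => Z (c t) X) (a := 0) (b := 1)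
    (K := K * ‖X‖) (fun t ht => (hder t ht).continuousAt.continuousWithinAt)
    (fun t ht => (hder t ⟨ht.1, ht.2.le⟩).hasDerivWithinAt)
    (by simp [hc, expUnit_zero, dualGroupAct_one, hrFb]) (fun t ht => by
      obtain ⟨h1, h2, h3, h4, -, h6⟩ := hcgood t ⟨ht.1, ht.2.le⟩
      have h0 := hZ0 (c t) h3 h4 h6 X hXL
      have : Z (c t) X = (Z (c t) - Z (F (r (c t)))) X := by
        rw [sub_apply (Z (c t)), h0, sub_zero]
      rw [this]
      refine (ContinuousLinearMap.le_opNorm _ _).trans ?_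
      have := hlip.norm_sub_le h1 h2
      calc _ ≤ (K * ‖c t - F (r (c t))‖) * ‖X‖ := by gcongr
        _ = _ := by ring) 1 (by simp)
  have := sub_eq_zero.1 hzero
  simpa [hc] using this.symm

/-- Points of an integral manifold of `L · η` near a given one are obtained from it by applying
`exp X` with small `X ∈ L`. -/
theorem IsPlaque.eventually_exists_expUnit [FiniteDimensional ℝ E]
    (hF : IsPlaque (orbitDistribution L) F U)
    (hb : b₀ ∈ U) {W : Set (A →L[ℝ] A)} (hW : W ∈ 𝓝[L] (0 : A →L[ℝ] A)) :
    ∀ᶠ b in 𝓝 b₀, ∃ X ∈ W, dualGroupAct (expUnit X) (F b₀) = F b := by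
  let _ : CompleteSpace E := FiniteDimensional.complete ℝ E
  obtain ⟨r, hr, hrF⟩ := exists_local_leftInverse (hF.contDiffAt b₀ hb) (hF.injective b₀ hb)
  have hflow : ∀ᶠ X in 𝓝[L] (0 : A →L[ℝ] A),
      F (r (dualGroupAct (expUnit X) (F b₀))) = dualGroupAct (expUnit X) (F b₀) := by
    have h1 := hF.eventually_expUnit_act hb hr hrF
    have h2 : Filter.Tendsto (fun X : A →L[ℝ] A => (X, b₀)) (𝓝[L] (0 : A →L[ℝ] A))
        (𝓝[L] (0 : A →L[ℝ] A) ×ˢ 𝓝 b₀) :=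
      Filter.tendsto_id.prodMk tendsto_const_nhds
    exact h2.eventually h1
  have hrs : HasStrictFDerivAt r (fderiv ℝ r (F b₀))
      (dualGroupAct (expUnit (0 : A →L[ℝ] A)) (F b₀)) := by
    rw [expUnit_zero, dualGroupAct_one]; exact hr.hasStrictFDerivAt (by simp)
  -- In plaque coordinates the map X ↦ exp X · F b₀ on `L` is a submersion at 0, since `L` · F b₀ is
  -- the tangent space. It therefore maps neighbourhoods of 0 onto neighbourhoods of `b₀`.
  have hθ := (hrs.comp (0 : A →L[ℝ] A) (hasStrictFDerivAt_expUnit_act_zero (F b₀))).comp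
    (f := L.subtypeL) (0 : L) (L.subtypeL.hasStrictFDerivAt)
  have hsurj : ((fderiv ℝ r (F b₀)).comp (dualActL A (F b₀)) ∘SL L.subtypeL).range = ⊤ := by
    rw [LinearMap.range_eq_top]
    intro v
    have h1 : fderiv ℝ F b₀ v ∈ orbitDistribution L (F b₀) := by
      rw [← hF.range_eq _ hb]; exact ⟨v, rfl⟩
    obtain ⟨X, hX, hXv⟩ := h1
    refine ⟨⟨X, hX⟩, ?_⟩
    have hc : HasFDerivAt (r ∘ F) (ContinuousLinearMap.id ℝ E) b₀ :=
      (hasFDerivAt_id _).congr_of_eventuallyEq hrF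
    have h2 := ((hr.differentiableAt (by simp)).hasFDerivAt.comp b₀
      ((hF.contDiffAt _ hb).differentiableAt (by simp)).hasFDerivAt).unique hc
    have h3 : fderiv ℝ r (F b₀) (fderiv ℝ F b₀ v) = v := DFunLike.congr_fun h2 v
    change fderiv ℝ r (F b₀) (dualAct (F b₀) X) = v
    rw [hXv, h3]
  have hmap := hθ.map_nhds_eq_of_surj hsurj
  have hW' : ∀ᶠ X in 𝓝[L] (0 : A →L[ℝ] A), X ∈ W ∧
      F (r (dualGroupAct (expUnit X) (F b₀))) = dualGroupAct (expUnit X) (F b₀) :=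
    Filter.Eventually.and hW hflow
  have hsub : ∀ᶠ X : L in 𝓝 0, (X : A →L[ℝ] A) ∈ W ∧
      F (r (dualGroupAct (expUnit (X : A →L[ℝ] A)) (F b₀))) =
        dualGroupAct (expUnit (X : A →L[ℝ] A)) (F b₀) := by
    have : 𝓝[L] (0 : A →L[ℝ] A) = Filter.map ((↑) : L → A →L[ℝ] A) (𝓝 0) :=
      nhdsWithin_eq_map_subtype_coe (s := (L : Set (A →L[ℝ] A))) L.zero_mem
    rwa [this, Filter.eventually_map] at hW'
  have him := Filter.image_mem_map (m := fun X : L =>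
    r (dualGroupAct (expUnit (X : A →L[ℝ] A)) (F b₀))) hsub
  have h0 : r (dualGroupAct (expUnit ((0 : L) : A →L[ℝ] A)) (F b₀)) = b₀ := by
    simp [expUnit_zero, dualGroupAct_one, hrF.self_of_nhds]
  have hmap' : Filter.map (fun X : L => r (dualGroupAct (expUnit (X : A →L[ℝ] A)) (F b₀))) (𝓝 0)
      = 𝓝 b₀ := by
    conv_rhs => rw [← h0]
    exact hmap
  rw [hmap'] at him
  filter_upwards [him]
  rintro _ ⟨X, ⟨hXW, hX⟩, rfl⟩
  exact ⟨X, hXW, hX.symm⟩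

end Flow

/-! ### Coordinates of the second kind and existence of plaques -/

section Parametrization

variable {A : Type u} [NormedAddCommGroup A] [NormedSpace ℝ A] [FiniteDimensional ℝ A]

theorem hasFDerivAt_expUnit_smul_act (X : A →L[ℝ] A) (s : ℝ) (η : StrongDual ℝ A) :
    HasFDerivAt (fun p : ℝ × StrongDual ℝ A => dualGroupAct (expUnit (p.1 • X)) p.2)
      ((ContinuousLinearMap.toSpanSingleton ℝ (dualAct (dualGroupAct (expUnit (s • X)) η) X)).coprod
        (dualGroupEquiv (expUnit (s • X)) : StrongDual ℝ A →L[ℝ] StrongDual ℝ A)) (s, η) := by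
  have hc : ContDiff ℝ ∞ fun p : ℝ × StrongDual ℝ A => dualGroupAct (expUnit (p.1 • X)) p.2 :=
    contDiff_expUnit_act.comp (f := fun p : ℝ × StrongDual ℝ A => (p.1 • X, p.2))
      (by fun_prop)
  have hd := (hc.differentiable (by simp) (s, η)).hasFDerivAt
  refine hd.congr_fderiv ?_
  have h1 : HasDerivAt (fun t : ℝ => (t, η)) ((1 : ℝ), (0 : StrongDual ℝ A)) s :=
    (hasDerivAt_id s).prodMk (hasDerivAt_const s η)
  have h2' := hd.comp_hasDerivAt s h1
  have h2 := h2'.unique (hasDerivAt_expUnit_act X η s)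
  have h3 : HasFDerivAt (fun θ : StrongDual ℝ A => (s, θ))
      (ContinuousLinearMap.inr ℝ ℝ (StrongDual ℝ A)) η := hasFDerivAt_prodMk_right s η
  have h4' := hd.comp η h3
  have h4 := h4'.unique
    ((dualGroupEquiv (expUnit (s • X))).hasFDerivAt (x := η))
  apply ContinuousLinearMap.prod_ext
  · ext1
    simpa using h2
  · rw [h4]
    ext; simp

/-- Coordinates of the second kind on an orbit of the group generated by `exp L`. -/
theorem exists_product_parametrization {L : LieSubalgebra ℝ (A →L[ℝ] A)}
    {S : Subgroup (A →L[ℝ] A)ˣ} (η : StrongDual ℝ A) :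
    ∀ (n : ℕ) (X : Fin n → (A →L[ℝ] A)), (∀ i, X i ∈ L) → (∀ i (t : ℝ), expUnit (t • X i) ∈ S) →
    ∃ F : (Fin n → ℝ) → StrongDual ℝ A, ContDiff ℝ ∞ F ∧ F 0 = η ∧
      (∀ b, ∃ g ∈ S, F b = dualGroupAct g η) ∧
      (∀ b v, fderiv ℝ F b v ∈ orbitDistribution L.toSubmodule (F b)) ∧
      ∀ v, fderiv ℝ F 0 v = ∑ i, v i • dualAct η (X i) := by
  intro n
  induction n with
  | zero =>
    intro X _ _
    refine ⟨fun _ => η, contDiff_const, rfl, fun b => ⟨1, S.one_mem, (dualGroupAct_one η).symm⟩,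
      fun b v => ?_, fun v => ?_⟩ <;> simp
  | succ n ih =>
    intro X hX hS
    obtain ⟨F, hF, hF0, hFS, hFd, hFd0⟩ := ih (fun i => X i.succ) (fun i => hX _) (fun i => hS _)
    let tl : (Fin (n + 1) → ℝ) →L[ℝ] (Fin n → ℝ) :=
      ContinuousLinearMap.pi fun i => ContinuousLinearMap.proj i.succ
    let hdl : (Fin (n + 1) → ℝ) →L[ℝ] ℝ := ContinuousLinearMap.proj 0
    set G : (Fin (n + 1) → ℝ) → StrongDual ℝ A := fun b =>
      dualGroupAct (expUnit (hdl b • X 0)) (F (tl b)) with hG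
    have hGd : ∀ b v, fderiv ℝ G b v = hdl v • dualAct (G b) (X 0) +
        dualGroupAct (expUnit (hdl b • X 0)) (fderiv ℝ F (tl b) (tl v)) := by
      intro b v
      have h1 := (hF.differentiable (by simp) (tl b)).hasFDerivAt.comp b (tl.hasFDerivAt (x := b))
      have h2 := (hasFDerivAt_expUnit_smul_act (X 0) (hdl b) (F (tl b))).comp b
        (f := fun b => (hdl b, F (tl b))) (hdl.hasFDerivAt.prodMk h1)
      have h3 : HasFDerivAt G _ b := h2
      rw [h3.fderiv]
      simp [hG]
    refine ⟨G, ?_, ?_, ?_, ?_, ?_⟩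
    · exact contDiff_expUnit_act.comp (f := fun b => (hdl b • X 0, F (tl b)))
        ((hdl.contDiff.smul contDiff_const).prodMk (hF.comp tl.contDiff))
    · simp [hG, expUnit_zero, dualGroupAct_one, hF0]
    · intro b
      obtain ⟨g, hg, hFg⟩ := hFS (tl b)
      exact ⟨_, mul_mem (hS 0 (hdl b)) hg, by simp only [hG]; rw [hFg, dualGroupAct_mul]⟩
    · intro b v
      rw [hGd]
      -- The derivative in the first coordinate is the field of `X 0`. The remaining part is a
      -- tangent vector moved by a group element, which stays tangent by equivariance.
      refine add_mem (Submodule.smul_mem _ _ ⟨X 0, hX 0, rfl⟩) ?_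
      simp only [hG]
      rw [orbitDistribution_dualGroupAct (expUnit_mem (L.smul_mem _ (hX 0)))]
      exact ⟨_, hFd (tl b) (tl v), rfl⟩
    · intro v
      rw [hGd, map_zero, map_zero, zero_smul, expUnit_zero, dualGroupAct_one, hFd0,
        Fin.sum_univ_succ]
      have hG0 : G 0 = η := by simp [hG, expUnit_zero, dualGroupAct_one, hF0]
      rw [hG0]
      rfl

/-- The subgroup generated by the one-parameter groups `exp (tX)`, `X ∈ Y`. -/
def oneParamGroup (Y : Set (A →L[ℝ] A)) : Subgroup (A →L[ℝ] A)ˣ :=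
  Subgroup.closure {g | ∃ X ∈ Y, ∃ t : ℝ, g = expUnit (t • X)}

theorem oneParamGroup_le {L : LieSubalgebra ℝ (A →L[ℝ] A)} {Y : Set (A →L[ℝ] A)}
    (hY : Y ⊆ L) : oneParamGroup Y ≤ expGroup L := by
  rw [oneParamGroup, Subgroup.closure_le]
  rintro _ ⟨X, hX, t, rfl⟩
  exact expUnit_mem (L.smul_mem t (hY hX))

/-- Every `L · η` has an integral manifold through `η`, contained in the orbit of the group
generated by the one-parameter groups of a spanning set of `L`. -/
theorem exists_plaque {L : LieSubalgebra ℝ (A →L[ℝ] A)} {Y : Set (A →L[ℝ] A)}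
    (hY : Submodule.span ℝ Y = L.toSubmodule) {η : StrongDual ℝ A} {k : ℕ}
    (hk : Module.finrank ℝ (orbitDistribution L.toSubmodule η) = k) :
    ∃ (F : EuclideanSpace ℝ (Fin k) → StrongDual ℝ A) (U : Set (EuclideanSpace ℝ (Fin k))),
      IsPlaque (orbitDistribution L.toSubmodule) F U ∧ 0 ∈ U ∧ F 0 = η ∧ Set.InjOn F U ∧
        ∀ b, ∃ g ∈ oneParamGroup Y, F b = dualGroupAct g η := by
  have hYL : Y ⊆ L := fun X hX => by
    have : X ∈ L.toSubmodule := hY ▸ Submodule.subset_span hX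
    exact this
  -- The basis of `L` · η is taken from `Y` itself, so that the plaque uses only the one-parameter
  -- groups of `Y`. With `Y` finite this later yields σ-compactness.
  obtain ⟨B, hB, hspan, hli⟩ := exists_linearIndependent ℝ (dualAct η '' Y)
  rw [Submodule.span_image, hY] at hspan
  change Submodule.span ℝ B = orbitDistribution L.toSubmodule η at hspan
  have hBfin : Finite B := hli.finite_of_isNoetherian
  have hcard : Nat.card B = k := by
    have := Fintype.ofFinite B
    rw [Nat.card_eq_fintype_card, ← hk, ← hspan, ← finrank_span_eq_card hli, Subtype.range_coe]
  let e : Fin k ≃ B := (Finite.equivFinOfCardEq hcard).symm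
  choose X hXY hXB using fun i : Fin k => hB (e i).2
  obtain ⟨F, hF, hF0, hFS, hFd, hFd0⟩ := exists_product_parametrization (L := L)
    (S := oneParamGroup Y) η k X (fun i => hYL (hXY i))
    (fun i t => Subgroup.subset_closure ⟨X i, hXY i, t, rfl⟩)
  let c : EuclideanSpace ℝ (Fin k) ≃L[ℝ] (Fin k → ℝ) := EuclideanSpace.equiv (Fin k) ℝ
  have hG : ContDiff ℝ ∞ (F ∘ c) := hF.comp c.contDiff
  have hGd : ∀ b v, fderiv ℝ (F ∘ c) b v = fderiv ℝ F (c b) (c v) := by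
    intro b v
    rw [((hF.differentiable (by simp) (c b)).hasFDerivAt.comp b (c.hasFDerivAt (x := b))).fderiv]
    rfl
  have hG0 : (F ∘ c) 0 = η := by simp [hF0]
  have hinj0 : Function.Injective (fderiv ℝ (F ∘ c) 0) := by
    have hli' : LinearIndependent ℝ fun i => ((e i : B) : StrongDual ℝ A) :=
      hli.comp e e.injective
    rw [injective_iff_map_eq_zero]
    intro v hv
    rw [hGd, map_zero, hFd0] at hv
    simp only [hXB] at hv
    have := Fintype.linearIndependent_iff.1 hli' (c v) hv
    exact c.map_eq_zero_iff.1 (funext this)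
  obtain ⟨r, -, hrF⟩ := exists_local_leftInverse (hG.contDiffAt (x := 0)) hinj0
  have hinjev : ∀ᶠ b in 𝓝 (0 : EuclideanSpace ℝ (Fin k)),
      Function.Injective (fderiv ℝ (F ∘ c) b) :=
    (hG.continuous_fderiv (by simp)).continuousAt.eventually
      (ContinuousLinearMap.isOpen_injective.mem_nhds hinj0)
  obtain ⟨U, hU, hUo, h0U⟩ := eventually_nhds_iff.1 (hrF.and hinjev)
  refine ⟨F ∘ c, U, ⟨hUo, fun b _ => hG.contDiffAt, fun b hb => (hU b hb).2, fun b hb => ?_⟩, h0U,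
    hG0, fun x hx y hy hxy => ?_, fun b => hFS (c b)⟩
  -- The image of the derivative lies in `L` · F b, and both have dimension `k`: the first by
  -- injectivity, the second by constancy of the rank along the orbit.
  · apply Submodule.eq_of_le_of_finrank_eq
    · rintro _ ⟨v, rfl⟩
      exact (hGd b v).symm ▸ hFd (c b) (c v)
    · obtain ⟨g, hg, hgF⟩ := hFS (c b)
      rw [LinearMap.finrank_range_of_inj (hU b hb).2, Function.comp_apply, hgF,
        finrank_orbitDistribution_dualGroupAct (oneParamGroup_le hYL hg), hk,
        finrank_euclideanSpace_fin]
  · rw [← (hU x hx).1, ← (hU y hy).1, hxy]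

end Parametrization

/-! ### The leaf topology -/

section LeafSpace

variable {A : Type u} [NormedAddCommGroup A] [NormedSpace ℝ A]

/-- `A*` with the leaf topology of the action of `exp L`. -/
@[ext]
structure LeafSpace (L : LieSubalgebra ℝ (A →L[ℝ] A)) : Type u where
  val : StrongDual ℝ A

variable {L : LieSubalgebra ℝ (A →L[ℝ] A)}

/-- The action of `Gl(A)` on the leaf space. -/
def LeafSpace.act (g : (A →L[ℝ] A)ˣ) (η : LeafSpace L) : LeafSpace L := ⟨dualGroupAct g η.val⟩

theorem LeafSpace.act_one (η : LeafSpace L) : η.act 1 = η := LeafSpace.ext (dualGroupAct_one _)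

theorem LeafSpace.act_mul (g h : (A →L[ℝ] A)ˣ) (η : LeafSpace L) :
    η.act (g * h) = (η.act h).act g := LeafSpace.ext (dualGroupAct_mul _ _ _)

variable [FiniteDimensional ℝ A]

/-- The condition mirrors `structureGroupTopology`, with exp X on the left. It makes sense on all of
A* at once, so leaves and orbits can be compared inside one space. -/
instance : TopologicalSpace (LeafSpace L) where
  IsOpen U := ∀ η ∈ U, ∀ᶠ X in 𝓝[L] (0 : A →L[ℝ] A), η.act (expUnit X) ∈ U
  isOpen_univ := fun _ _ => Filter.Eventually.of_forall fun _ => trivial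
  isOpen_inter := fun _ _ hU hV η hη => (hU η hη.1).and (hV η hη.2)
  isOpen_sUnion := fun _ hS η ⟨U, hU, hη⟩ => (hS U hU η hη).mono fun _ h => ⟨U, hU, h⟩

theorem LeafSpace.isOpen_iff {U : Set (LeafSpace L)} :
    IsOpen U ↔ ∀ η ∈ U, ∀ᶠ X in 𝓝[L] (0 : A →L[ℝ] A), η.act (expUnit X) ∈ U := Iff.rfl

theorem LeafSpace.continuous_val : Continuous (LeafSpace.val : LeafSpace L → StrongDual ℝ A) := by
  rw [continuous_def]
  intro S hS η hη
  have h : Filter.Tendsto (fun X : A →L[ℝ] A => dualGroupAct (expUnit X) η.val) (𝓝 0)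
      (𝓝 η.val) := by
    have := (contDiff_expUnit_act.continuous.comp
      (Continuous.prodMk_left (X := (A →L[ℝ] A)) η.val)).tendsto 0
    simpa [Function.comp_def, expUnit_zero, dualGroupAct_one] using this
  exact (h.eventually (hS.mem_nhds hη)).filter_mono nhdsWithin_le_nhds

instance : T2Space (LeafSpace L) :=
  T2Space.of_injective_continuous (fun _ _ h => LeafSpace.ext h) LeafSpace.continuous_val

theorem tendsto_conj {g : (A →L[ℝ] A)ˣ} (hg : g ∈ expGroup L) :
    Filter.Tendsto (fun X : A →L[ℝ] A => (g : A →L[ℝ] A) * X * ((g⁻¹ : (A →L[ℝ] A)ˣ) : A →L[ℝ] A))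
      (𝓝[L] 0) (𝓝[L] 0) := by
  refine tendsto_nhdsWithin_iff.2 ⟨?_, ?_⟩
  · have : Continuous fun X : A →L[ℝ] A =>
      (g : A →L[ℝ] A) * X * ((g⁻¹ : (A →L[ℝ] A)ˣ) : A →L[ℝ] A) := by fun_prop
    have h0 := this.tendsto 0
    rw [mul_zero, zero_mul] at h0
    exact h0.mono_left nhdsWithin_le_nhds
  · filter_upwards [self_mem_nhdsWithin] with X hX using conj_mem hg hX

/-- Holds because g exp X = exp(g X g⁻¹) g, and conjugation by g sends small elements of `L` to
small elements of `L`. -/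
theorem LeafSpace.continuous_act {g : (A →L[ℝ] A)ˣ} (hg : g ∈ expGroup L) :
    Continuous (LeafSpace.act g : LeafSpace L → LeafSpace L) := by
  rw [continuous_def]
  intro S hS η hη
  filter_upwards [(tendsto_conj hg).eventually (LeafSpace.isOpen_iff.1 hS _ hη)] with X hX
  rw [expUnit_conj, ← LeafSpace.act_mul, inv_mul_cancel_right, LeafSpace.act_mul] at hX
  exact hX

section Nhds

variable {E : Type*} [NormedAddCommGroup E] [NormedSpace ℝ E] [FiniteDimensional ℝ E]
  {F : E → StrongDual ℝ A} {U : Set E}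

/-- By local invariance, exp X · F b is again a plaque point, with parameter r(exp X · F b), which
is close to b for small X. -/
theorem IsPlaque.isOpen_image (hF : IsPlaque (orbitDistribution L.toSubmodule) F U)
    {W : Set E} (hW : IsOpen W) (hWU : W ⊆ U) :
    IsOpen ((fun b => (⟨F b⟩ : LeafSpace L)) '' W) := by
  rw [LeafSpace.isOpen_iff]
  rintro _ ⟨b, hb, rfl⟩
  obtain ⟨r, hr, hrF⟩ := exists_local_leftInverse (hF.contDiffAt b (hWU hb))
    (hF.injective b (hWU hb))
  have h1 := hF.eventually_expUnit_act (hWU hb) hr hrF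
  have h2 : Filter.Tendsto (fun X : A →L[ℝ] A => (X, b)) (𝓝[L] (0 : A →L[ℝ] A))
      (𝓝[L.toSubmodule] (0 : A →L[ℝ] A) ×ˢ 𝓝 b) :=
    Filter.tendsto_id.prodMk tendsto_const_nhds
  have h3 : Filter.Tendsto (fun X : A →L[ℝ] A => r (dualGroupAct (expUnit X) (F b)))
      (𝓝[L] (0 : A →L[ℝ] A)) (𝓝 b) := by
    have hrc : ContinuousAt r (dualGroupAct (expUnit (0 : A →L[ℝ] A)) (F b)) := by
      rw [expUnit_zero, dualGroupAct_one]; exact hr.continuousAt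
    have h := hrc.comp (f := fun X : A →L[ℝ] A => dualGroupAct (expUnit X) (F b))
      (hasStrictFDerivAt_expUnit_act_zero (F b)).continuousAt
    have h' : Filter.Tendsto _ _ _ := h
    simp only [Function.comp_apply, expUnit_zero, dualGroupAct_one, hrF.self_of_nhds] at h'
    exact h'.mono_left nhdsWithin_le_nhds
  filter_upwards [h2.eventually h1, h3 (hW.mem_nhds hb)] with X h4 h5
  exact ⟨_, h5, LeafSpace.ext h4⟩

/-- The converse direction: nearby plaque points are reached from F b by some small exp X. -/
theorem IsPlaque.continuousAt (hF : IsPlaque (orbitDistribution L.toSubmodule) F U)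
    {b : E} (hb : b ∈ U) : ContinuousAt (fun b => (⟨F b⟩ : LeafSpace L)) b := by
  rw [ContinuousAt, tendsto_nhds]
  intro S hS hbS
  filter_upwards [hF.eventually_exists_expUnit hb (LeafSpace.isOpen_iff.1 hS _ hbS)]
  rintro x ⟨X, hX, hXx⟩
  change (⟨F x⟩ : LeafSpace L) ∈ S
  rw [← hXx]
  exact hX

theorem IsPlaque.map_nhds (hF : IsPlaque (orbitDistribution L.toSubmodule) F U)
    {b : E} (hb : b ∈ U) :
    Filter.map (fun b => (⟨F b⟩ : LeafSpace L)) (𝓝 b) = 𝓝 ⟨F b⟩ := by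
  refine le_antisymm (hF.continuousAt hb) fun S hS => ?_
  obtain ⟨W, hWS, hW, hbW⟩ := mem_nhds_iff.1 (Filter.mem_map.1 hS)
  refine Filter.mem_of_superset ((hF.isOpen_image (hW.inter hF.isOpen)
    Set.inter_subset_right).mem_nhds ⟨b, ⟨hbW, hb⟩, rfl⟩) ?_
  rintro _ ⟨x, hx, rfl⟩
  exact hWS hx.1

end Nhds

/-- The flow of a vector field `η ↦ X · η`, `X ∈ L`, is continuous for the leaf topology. -/
theorem LeafSpace.continuous_flow {X : A →L[ℝ] A} (hX : X ∈ L) :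
    Continuous fun p : ℝ × LeafSpace L => p.2.act (expUnit (p.1 • X)) := by
  have h0 : ∀ η : LeafSpace L,
      ContinuousAt (fun p : ℝ × LeafSpace L => p.2.act (expUnit (p.1 • X))) (0, η) := by
    rintro ⟨η⟩
    obtain ⟨k, hk⟩ : ∃ k, Module.finrank ℝ (orbitDistribution L.toSubmodule η) = k := ⟨_, rfl⟩
    obtain ⟨F, U, hF, h0U, rfl, -, -⟩ := exists_plaque (L := L) (Y := L)
      (Submodule.span_eq L.toSubmodule) hk
    obtain ⟨r, hr, hrF⟩ := exists_local_leftInverse (hF.contDiffAt 0 h0U) (hF.injective 0 h0U)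
    have h1 := hF.eventually_expUnit_act h0U hr hrF
    -- Neighbourhoods of η come from the plaque, so continuity at time 0 can be checked in its
    -- coordinates, where the flow reads b ↦ r(exp(tX) · F b).
    rw [ContinuousAt, nhds_prod_eq, ← hF.map_nhds h0U, ← Filter.map_id (f := 𝓝 (0 : ℝ)),
      Filter.prod_map_map_eq, Filter.tendsto_map'_iff]
    have ht : Filter.Tendsto (fun p : ℝ × _ => (p.1 • X, p.2)) (𝓝 (0 : ℝ) ×ˢ 𝓝 0)
        (𝓝[L.toSubmodule] (0 : A →L[ℝ] A) ×ˢ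
          𝓝 (0 : EuclideanSpace ℝ (Fin k))) := by
      refine Filter.Tendsto.prodMk ?_ Filter.tendsto_snd
      refine Filter.Tendsto.comp (g := fun t : ℝ => t • X) ?_ Filter.tendsto_fst
      refine tendsto_nhdsWithin_iff.2 ⟨?_, Filter.Eventually.of_forall fun t => L.smul_mem t hX⟩
      have : Continuous fun t : ℝ => t • X := by fun_prop
      simpa using this.tendsto 0
    have h2 : Filter.Tendsto (fun p : ℝ × _ => r (dualGroupAct (expUnit (p.1 • X)) (F p.2)))
        (𝓝 (0 : ℝ) ×ˢ 𝓝 0) (𝓝 0) := by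
      have hc : ContinuousAt (fun p : ℝ × _ => dualGroupAct (expUnit (p.1 • X)) (F p.2)) (0, 0) := by
        have hc1 : ContinuousAt (fun p : ℝ × _ => (p.1 • X, F p.2)) (0, 0) :=
          (continuousAt_fst.smul continuousAt_const).prodMk
            ((hF.contDiffAt 0 h0U).continuousAt.comp (f := Prod.snd) (x := ((0 : ℝ), _))
              continuousAt_snd)
        exact contDiff_expUnit_act.continuous.continuousAt.comp
          (f := fun p : ℝ × _ => (p.1 • X, F p.2)) (x := (0, 0)) hc1
      have h := ContinuousAt.comp (g := r)
        (f := fun p : ℝ × _ => dualGroupAct (expUnit (p.1 • X)) (F p.2)) (x := (0, 0))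
        (by simpa [expUnit_zero, dualGroupAct_one] using hr.continuousAt) hc
      have h' : Filter.Tendsto _ _ _ := h
      simpa [Function.comp_def, expUnit_zero, dualGroupAct_one, hrF.self_of_nhds, nhds_prod_eq]
        using h'
    have h3 : Filter.Tendsto
        (fun p : ℝ × _ => (⟨F (r (dualGroupAct (expUnit (p.1 • X)) (F p.2)))⟩ : LeafSpace L))
        (𝓝 (0 : ℝ) ×ˢ 𝓝 0) (𝓝 ⟨F 0⟩) :=
      Filter.Tendsto.comp (g := fun b => (⟨F b⟩ : LeafSpace L)) (hF.continuousAt h0U) h2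
    have h4 : LeafSpace.act (expUnit ((0 : ℝ) • X)) (⟨F 0⟩ : LeafSpace L) = ⟨F 0⟩ := by
      rw [zero_smul, expUnit_zero, LeafSpace.act_one]
    simp only [h4]
    refine h3.congr' ?_
    filter_upwards [ht.eventually h1] with p hp
    exact LeafSpace.ext hp
  rw [continuous_iff_continuousAt]
  rintro ⟨t, η⟩
  -- Time `t` reduces to time 0 through exp(sX) = exp(tX) exp((s - t)X).
  have h1 : ContinuousAt (fun p : ℝ × LeafSpace L => (p.1 - t, p.2)) (t, η) := by fun_prop
  have h2 : ContinuousAt (fun p : ℝ × LeafSpace L => p.2.act (expUnit ((p.1 - t) • X))) (t, η) := by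
    have h0' := h0 η
    rw [← sub_self t] at h0'
    exact h0'.comp (f := fun p : ℝ × LeafSpace L => (p.1 - t, p.2)) (x := (t, η)) h1
  have h3 := (LeafSpace.continuous_act (expUnit_mem (L.smul_mem t hX))).continuousAt.comp h2
  refine h3.congr (Filter.Eventually.of_forall fun p => ?_)
  simp only [Function.comp_apply]
  rw [← LeafSpace.act_mul, ← expUnit_add (((Commute.refl X).smul_left t).smul_right _), ← add_smul,
    add_sub_cancel]

end LeafSpace

/-! ### Integral leaves from plaques, and plaques from leaves -/

section Build

/-- The charted space structure given by a choice of a chart at each point. -/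
abbrev chartedSpaceOfCharts {H M : Type*} [TopologicalSpace H] [TopologicalSpace M]
    (φ : M → OpenPartialHomeomorph M H) (hφ : ∀ x, x ∈ (φ x).source) : ChartedSpace H M where
  atlas := Set.range φ
  chartAt := φ
  mem_chart_source := hφ
  chart_mem_atlas x := ⟨x, rfl⟩

variable {V : Type u} [NormedAddCommGroup V] [NormedSpace ℝ V]

/-- A space which is locally parametrized by integral manifolds of `D` is an immersed
submanifold, and an integral leaf. -/
theorem exists_leaf_of_plaques [FiniteDimensional ℝ V] {M : Type u} [TopologicalSpace M] [T2Space M]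
    [SecondCountableTopology M] {k : ℕ} {f : M → V} (hf : Function.Injective f)
    (D : SmoothDistribution V)
    (h : ∀ x : M, ∃ φ : OpenPartialHomeomorph M (EuclideanSpace ℝ (Fin k)), x ∈ φ.source ∧
      IsPlaque D.fiber (f ∘ φ.symm) φ.target) :
    ∃ (N : ImmersedSubmanifold V) (e : N.carrier ≃ₜ M), (∀ x, f (e x) = N.incl x) ∧
      IsIntegralLeaf D N := by
  choose φ hφ hpl using h
  let _ : ChartedSpace (EuclideanSpace ℝ (Fin k)) M := chartedSpaceOfCharts φ hφ
  have hman : IsManifold (𝓡 k) ∞ M := by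
    apply isManifold_of_contDiffOn
    rintro _ _ ⟨x, rfl⟩ ⟨x', rfl⟩
    simp only [mfld_simps, Function.comp_def, modelWithCornersSelf_coe, modelWithCornersSelf_coe_symm]
    rintro y ⟨hy, hy'⟩
    apply ContDiffAt.contDiffWithinAt
    have hz : φ x' ((φ x).symm y) ∈ (φ x').target := (φ x').map_source hy'
    -- Locally the transition map is `r` composed with the parametrization at `x`, where `r` is a
    -- smooth left inverse of the one at `x'`. Hence it is smooth.
    obtain ⟨r, hr, hrF⟩ := exists_local_leftInverse ((hpl x').contDiffAt _ hz)
      ((hpl x').injective _ hz)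
    have hfx : (f ∘ (φ x').symm) (φ x' ((φ x).symm y)) = (f ∘ (φ x).symm) y := by
      simp [(φ x').left_inv hy']
    rw [hfx] at hr
    have hsm := hr.comp y ((hpl x).contDiffAt y hy)
    refine hsm.congr_of_eventuallyEq ?_
    have hcont : ContinuousAt (fun y => φ x' ((φ x).symm y)) y :=
      ((φ x').continuousAt hy').comp ((φ x).symm.continuousAt hy)
    filter_upwards [hcont.eventually hrF,
      ((φ x).symm.continuousAt hy).eventually ((φ x').open_source.mem_nhds hy')] with z h1 h2
    rw [Function.comp_apply, (φ x').left_inv h2] at h1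
    exact h1.symm
  have hcont : Continuous f := by
    rw [continuous_iff_continuousAt]
    intro x
    have h1 := ((hpl x).contDiffAt _ ((φ x).map_source (hφ x))).continuousAt.comp
      ((φ x).continuousAt (hφ x))
    refine h1.congr ?_
    filter_upwards [(φ x).open_source.mem_nhds (hφ x)] with y hy
    simp [(φ x).left_inv hy]
  have hsm : ContMDiff (𝓡 k) 𝓘(ℝ, V) ∞ f := by
    intro x
    rw [contMDiffAt_iff]
    refine ⟨hcont.continuousAt, ?_⟩
    simp only [mfld_simps]
    exact ((hpl x).contDiffAt _ ((φ x).map_source (hφ x))).contDiffWithinAt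
  have hder : ∀ x, (mfderiv (𝓡 k) 𝓘(ℝ, V) f x : EuclideanSpace ℝ (Fin k) →L[ℝ] V) =
      fderiv ℝ (f ∘ (φ x).symm) (φ x x) := by
    intro x
    rw [((hsm x).mdifferentiableAt (by simp)).mfderiv]
    simp only [mfld_simps, fderivWithin_univ]
    rfl
  let N : ImmersedSubmanifold V :=
    { carrier := M, dim := k, incl := f, injective := hf, contMDiff := hsm
      immersion := fun x => by
        have := (hpl x).injective _ ((φ x).map_source (hφ x))
        rw [← hder x] at this
        exact this }
  refine ⟨N, Homeomorph.refl M, fun x => rfl, fun x => ?_⟩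
  have := (hpl x).range_eq _ ((φ x).map_source (hφ x))
  rw [← hder x, Function.comp_apply, (φ x).left_inv (hφ x)] at this
  exact this

/-- The charts of an integral leaf are integral manifolds. -/
theorem IsIntegralLeaf.isPlaque {D : SmoothDistribution V} {N : ImmersedSubmanifold V}
    (hN : IsIntegralLeaf D N) (x : N.carrier) :
    IsPlaque D.fiber
      (N.incl ∘ (chartAt (EuclideanSpace ℝ (Fin N.dim)) x).symm)
      (chartAt (EuclideanSpace ℝ (Fin N.dim)) x).target := by
  set φ := chartAt (EuclideanSpace ℝ (Fin N.dim)) x with hφ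
  have hsm : ∀ b ∈ φ.target, ContDiffAt ℝ ∞ (N.incl ∘ φ.symm) b := by
    intro b hb
    rw [← contMDiffAt_iff_contDiffAt]
    exact (N.contMDiff (φ.symm b)).comp b
      ((contMDiffOn_chart_symm (I := 𝓡 N.dim) (n := ∞) (x := x)).contMDiffAt
        (φ.open_target.mem_nhds hb))
  have hmd : φ.MDifferentiable (𝓡 N.dim) (𝓡 N.dim) := by
    have : IsManifold (𝓡 N.dim) 1 N.carrier := IsManifold.of_le (n := ∞) (by exact_mod_cast le_top)
    exact mdifferentiable_chart x
  have hder : ∀ b ∈ φ.target, ∀ v, fderiv ℝ (N.incl ∘ φ.symm) b v =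
      mfderiv (𝓡 N.dim) 𝓘(ℝ, V) N.incl (φ.symm b)
        (mfderiv (𝓡 N.dim) (𝓡 N.dim) φ.symm b v) := by
    intro b hb v
    have h1 := mfderiv_comp b ((N.contMDiff (φ.symm b)).mdifferentiableAt (by simp))
      (hmd.mdifferentiableAt_symm hb)
    rw [mfderiv_eq_fderiv] at h1
    exact DFunLike.congr_fun h1 v
  refine ⟨φ.open_target, hsm, fun b hb v w hvw => ?_, fun b hb => ?_⟩
  · rw [hder b hb, hder b hb] at hvw
    exact hmd.symm.mfderiv_injective hb (N.immersion _ hvw)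
  · rw [Function.comp_apply, ← hN (φ.symm b)]
    ext w
    constructor
    · rintro ⟨v, rfl⟩
      exact ⟨_, (hder b hb v).symm⟩
    · rintro ⟨v, rfl⟩
      obtain ⟨w, rfl⟩ := hmd.symm.mfderiv_surjective hb v
      exact ⟨w, hder b hb w⟩

end Build

/-! ### Rank of a linear image -/

section LinearFamilies

variable {W V : Type*} [AddCommGroup W] [Module ℝ W] [AddCommGroup V] [Module ℝ V]
  [FiniteDimensional ℝ V]

/-- Together with `card_le_finrank_map` this gives lower semicontinuity of the rank: the lifts `X`
are fixed vectors of `m`, and their images remain independent when `f` varies a little. -/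
theorem exists_linearIndependent_map (m : Submodule ℝ W) (f : W →ₗ[ℝ] V) :
    ∃ X : Fin (Module.finrank ℝ (m.map f)) → W, (∀ i, X i ∈ m) ∧
      LinearIndependent ℝ fun i => f (X i) := by
  let b := Module.finBasis ℝ (m.map f)
  choose X hXm hX using fun i => (b i).2
  refine ⟨X, hXm, ?_⟩
  simp only [hX]
  exact b.linearIndependent.map' (Submodule.subtype _) (Submodule.ker_subtype _)

theorem card_le_finrank_map {n : ℕ} {m : Submodule ℝ W} {f : W →ₗ[ℝ] V} {X : Fin n → W}
    (hX : ∀ i, X i ∈ m) (hli : LinearIndependent ℝ fun i => f (X i)) :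
    n ≤ Module.finrank ℝ (m.map f) := by
  have h4 : LinearIndependent ℝ fun i => (⟨f (X i), X i, hX i, rfl⟩ : m.map f) :=
    LinearIndependent.of_comp (Submodule.subtype _) hli
  simpa using h4.fintype_card_le_finrank

end LinearFamilies

/-! ### Orbits and open subsets of the leaf space -/

section Orbits

variable {A : Type u} [NormedAddCommGroup A] [NormedSpace ℝ A] [FiniteDimensional ℝ A]
  {L : LieSubalgebra ℝ (A →L[ℝ] A)}

theorem isOpen_setOf_finrank_eq (k : ℕ) :
    IsOpen {η : LeafSpace L | Module.finrank ℝ (orbitDistribution L.toSubmodule η.val) = k} := by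
  rw [LeafSpace.isOpen_iff]
  intro η hη
  filter_upwards [self_mem_nhdsWithin] with X hX
  exact (finrank_orbitDistribution_dualGroupAct (expUnit_mem hX) η.val).trans hη

/-- The points at which a subspace `m` of `L` spans the tangent space of the orbit form an open
set. -/
theorem isOpen_setOf_orbitDistribution_eq {m : Submodule ℝ (A →L[ℝ] A)} (hm : m ≤ L.toSubmodule) :
    IsOpen {η : LeafSpace L |
      orbitDistribution m η.val = orbitDistribution L.toSubmodule η.val} := by
  rw [isOpen_iff_mem_nhds]
  intro η hη
  obtain ⟨X, hXm, hli⟩ := exists_linearIndependent_map m (dualAct η.val)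
  have hc : Continuous fun (θ : StrongDual ℝ A) i => dualAct θ (X i) :=
    continuous_pi fun i => by
      change Continuous fun θ : StrongDual ℝ A => dualActL A θ (X i)
      exact (ContinuousLinearMap.continuous (dualActL A)).clm_apply continuous_const
  have h1 : ∀ᶠ θ : LeafSpace L in 𝓝 η, LinearIndependent ℝ fun i => dualAct θ.val (X i) :=
    (hc.comp LeafSpace.continuous_val).continuousAt.eventually hli.eventually
  -- Near η the dimension of `m` · θ cannot drop, while that of `L` · θ is locally constant, so the
  -- inclusion remains an equality.
  filter_upwards [h1, (isOpen_setOf_finrank_eq (L := L) _).mem_nhds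
    (congrArg (fun W : Submodule ℝ (StrongDual ℝ A) => Module.finrank ℝ W) hη.symm)] with θ h2 h3
  refine Submodule.eq_of_le_of_finrank_le (Submodule.map_mono hm) ?_
  rw [h3]
  exact card_le_finrank_map hXm h2

/-- The orbits of the subgroups generated by enough one-parameter groups are open and closed. -/
theorem isClopen_orbit {Y : Set (A →L[ℝ] A)} (hY : Submodule.span ℝ Y = L.toSubmodule)
    (ξ : LeafSpace L) : IsClopen {η : LeafSpace L | ∃ g ∈ oneParamGroup Y, η = ξ.act g} := by
  -- The plaque through η is a neighbourhood inside the orbit of η. Orbits are thus open, and they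
  -- are closed because they partition the space.
  have key : ∀ η : LeafSpace L, ∀ᶠ θ in 𝓝 η, ∃ g ∈ oneParamGroup Y, θ = η.act g := by
    rintro ⟨η⟩
    obtain ⟨F, U, hF, h0U, hF0, -, hg⟩ := exists_plaque hY (η := η) rfl
    have h1 := hF.map_nhds h0U
    rw [hF0] at h1
    rw [← h1, Filter.eventually_map]
    refine Filter.Eventually.of_forall fun b => ?_
    obtain ⟨g, hg, hb⟩ := hg b
    exact ⟨g, hg, LeafSpace.ext hb⟩
  constructor
  · rw [← isOpen_compl_iff, isOpen_iff_mem_nhds]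
    intro η hη
    filter_upwards [key η]
    rintro _ ⟨g, hg, rfl⟩ ⟨h, hh, hgh⟩
    refine hη ⟨g⁻¹ * h, mul_mem (inv_mem hg) hh, ?_⟩
    rw [LeafSpace.act_mul, ← hgh, ← LeafSpace.act_mul, inv_mul_cancel, LeafSpace.act_one]
  · rw [isOpen_iff_mem_nhds]
    rintro _ ⟨h, hh, rfl⟩
    filter_upwards [key (ξ.act h)]
    rintro _ ⟨g, hg, rfl⟩
    exact ⟨g * h, mul_mem hg hh, (LeafSpace.act_mul _ _ _).symm⟩

theorem oneParamGroup_coe : oneParamGroup (L : Set (A →L[ℝ] A)) = expGroup L := by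
  refine le_antisymm (oneParamGroup_le subset_rfl) ((Subgroup.closure_le _).2 ?_)
  rintro _ ⟨X, hX, rfl⟩
  exact Subgroup.subset_closure ⟨X, hX, 1, by rw [one_smul]⟩

theorem isClopen_expGroup_orbit (ξ : LeafSpace L) :
    IsClopen {η : LeafSpace L | ∃ g ∈ expGroup L, η = ξ.act g} := by
  rw [← oneParamGroup_coe]
  exact isClopen_orbit (Submodule.span_eq L.toSubmodule) ξ

/-- The points reached from ξ by finitely many flows of elements of `Y` with bounded times form a
compact set. Finiteness of `Y` makes each stage a finite union of continuous images of compact sets.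
-/
theorem isSigmaCompact_orbit {Y : Set (A →L[ℝ] A)} (hYfin : Y.Finite)
    (hY : Y ⊆ L) (ξ : LeafSpace L) :
    IsSigmaCompact {η : LeafSpace L | ∃ g ∈ oneParamGroup Y, η = ξ.act g} := by
  let K : ℕ → Set (LeafSpace L) := fun n => Nat.rec {ξ} (fun n S => S ∪ ⋃ X ∈ Y,
    (fun p : ℝ × LeafSpace L => p.2.act (expUnit (p.1 • X))) ''
      (Set.Icc (-(n : ℝ)) n ×ˢ S)) n
  have hK : ∀ n, K (n + 1) = K n ∪ ⋃ X ∈ Y,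
    (fun p : ℝ × LeafSpace L => p.2.act (expUnit (p.1 • X))) ''
      (Set.Icc (-(n : ℝ)) n ×ˢ K n) := fun n => rfl
  have hK0 : K 0 = {ξ} := rfl
  clear_value K
  have hcpt : ∀ n, IsCompact (K n) := by
    intro n
    induction n with
    | zero => rw [hK0]; exact isCompact_singleton
    | succ n ih =>
      rw [hK]
      exact ih.union (hYfin.isCompact_biUnion fun X hX =>
        (isCompact_Icc.prod ih).image (LeafSpace.continuous_flow (hY hX)))
  have hmono : Monotone K := monotone_nat_of_le_succ fun n => by
    rw [hK]; exact Set.subset_union_left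
  have hflow : ∀ X ∈ Y, ∀ t : ℝ, ∀ η ∈ ⋃ n, K n, η.act (expUnit (t • X)) ∈ ⋃ n, K n := by
    intro X hX t η hη
    obtain ⟨n, hn⟩ := Set.mem_iUnion.1 hη
    obtain ⟨m, hm⟩ := exists_nat_ge |t|
    -- Stage `max n m` already contains η and allows times up to |t|; applying the flow costs one
    -- further stage.
    refine Set.mem_iUnion.2 ⟨max n m + 1, ?_⟩
    rw [hK]
    refine Or.inr (Set.mem_biUnion hX ⟨(t, η), ⟨abs_le.1 (hm.trans ?_), hmono (le_max_left _ _) hn⟩,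
      rfl⟩)
    exact_mod_cast le_max_right n m
  have hact : ∀ g ∈ oneParamGroup Y, ∀ η ∈ ⋃ n, K n, η.act g ∈ ⋃ n, K n := by
    intro g hg
    induction hg using Subgroup.closure_induction'' with
    | mem x hx =>
      obtain ⟨X, hX, t, rfl⟩ := hx
      exact hflow X hX t
    | inv_mem x hx =>
      obtain ⟨X, hX, t, rfl⟩ := hx
      rw [← expUnit_neg, ← neg_smul]
      exact hflow X hX (-t)
    | one => intro η hη; rwa [LeafSpace.act_one]
    | mul x y _ _ hx hy => intro η hη; rw [LeafSpace.act_mul]; exact hx _ (hy _ hη)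
  have heq : {η : LeafSpace L | ∃ g ∈ oneParamGroup Y, η = ξ.act g} = ⋃ n, K n := by
    apply Set.Subset.antisymm
    · rintro _ ⟨g, hg, rfl⟩
      exact hact g hg ξ (Set.mem_iUnion.2 ⟨0, by rw [hK0]; rfl⟩)
    · refine Set.iUnion_subset fun n => ?_
      induction n with
      | zero => rw [hK0]; rintro _ rfl; exact ⟨1, one_mem _, (LeafSpace.act_one _).symm⟩
      | succ n ih =>
        rw [hK]
        refine Set.union_subset ih (Set.iUnion₂_subset fun X hX => ?_)
        rintro _ ⟨⟨t, η⟩, ⟨-, hη⟩, rfl⟩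
        obtain ⟨g, hg, rfl⟩ := ih hη
        exact ⟨_, mul_mem (Subgroup.subset_closure ⟨X, hX, t, rfl⟩) hg,
          (LeafSpace.act_mul _ _ _).symm⟩
  rw [heq]
  exact isSigmaCompact_iUnion_of_isCompact K hcpt

/-- Connected components of open subsets of the leaf space are open. -/
theorem LeafSpace.isOpen_connectedComponentIn {S : Set (LeafSpace L)} (hS : IsOpen S)
    (ξ : LeafSpace L) : IsOpen (connectedComponentIn S ξ) := by
  rw [LeafSpace.isOpen_iff]
  intro η hη
  have hηS := connectedComponentIn_subset S ξ hη
  have h := LeafSpace.isOpen_iff.1 hS η hηS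
  obtain ⟨δ, hδ, hball⟩ := Metric.mem_nhdsWithin_iff.1 h
  rw [connectedComponentIn_eq hη]
  filter_upwards [self_mem_nhdsWithin, mem_nhdsWithin_of_mem_nhds (Metric.ball_mem_nhds _ hδ)]
    with X hXL hXδ
  -- The flow segment from η to exp X · η is connected and stays in `S`, because the ball of
  -- admissible X is star-shaped.
  have hpre : IsPreconnected ((fun t : ℝ => η.act (expUnit (t • X))) '' Set.Icc 0 1) :=
    isPreconnected_Icc.image _ ((LeafSpace.continuous_flow hXL).comp
      (Continuous.prodMk_left (X := ℝ) η)).continuousOn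
  refine hpre.subset_connectedComponentIn ⟨0, by simp, ?_⟩ ?_ ⟨1, by simp, ?_⟩
  · simp [expUnit_zero, LeafSpace.act_one]
  · rintro _ ⟨t, ht, rfl⟩
    refine hball ⟨?_, L.smul_mem t hXL⟩
    rw [mem_ball_zero_iff, norm_smul, Real.norm_of_nonneg ht.1]
    exact (mul_le_of_le_one_left (norm_nonneg X) ht.2).trans_lt (mem_ball_zero_iff.1 hXδ)
  · simp

/-- Charts of open subsets of the leaf space. -/
theorem exists_chart {k : ℕ} (Ω : TopologicalSpace.Opens (LeafSpace L))
    (hΩ : ∀ η ∈ Ω, Module.finrank ℝ (orbitDistribution L.toSubmodule η.val) = k) (x : Ω) :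
    ∃ φ : OpenPartialHomeomorph Ω (EuclideanSpace ℝ (Fin k)), x ∈ φ.source ∧
      IsPlaque (orbitDistribution L.toSubmodule) ((fun η : Ω => η.1.val) ∘ φ.symm) φ.target := by
  obtain ⟨F, U, hF, h0U, hF0, hinj, -⟩ := exists_plaque (L := L) (Y := L)
    (Submodule.span_eq L.toSubmodule) (hΩ x x.2)
  have hinj' : Set.InjOn (fun b => (⟨F b⟩ : LeafSpace L)) U := fun a ha b hb hab =>
    hinj ha hb (congrArg LeafSpace.val hab)
  let e : OpenPartialHomeomorph (EuclideanSpace ℝ (Fin k)) (LeafSpace L) :=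
    OpenPartialHomeomorph.ofContinuousOpenRestrict (hinj'.toPartialEquiv _ _)
      (fun b hb => (hF.continuousAt hb).continuousWithinAt)
      (by
        intro W hW
        obtain ⟨W', hW', rfl⟩ := isOpen_induced_iff.1 hW
        convert hF.isOpen_image (hW'.inter hF.isOpen) Set.inter_subset_right using 1
        ext y
        constructor
        · rintro ⟨⟨b, hbU⟩, hb, rfl⟩
          exact ⟨b, ⟨hb, hbU⟩, rfl⟩
        · rintro ⟨b, ⟨hb, hbU⟩, rfl⟩
          exact ⟨⟨b, hbU⟩, hb, rfl⟩) hF.isOpen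
  have hxe : (x : LeafSpace L) ∈ e.symm.source := ⟨0, h0U, LeafSpace.ext hF0⟩
  refine ⟨e.symm.subtypeRestr ⟨x⟩, ?_, ?_⟩
  · rw [OpenPartialHomeomorph.subtypeRestr_source]
    exact hxe
  · have hsub : (e.symm.subtypeRestr ⟨x⟩).target ⊆ U :=
      OpenPartialHomeomorph.subtypeRestr_target_subset e.symm ⟨x⟩
    refine (hF.mono (e.symm.subtypeRestr ⟨x⟩).open_target hsub).congr fun b hb => ?_
    have h := OpenPartialHomeomorph.subtypeRestr_symm_apply e.symm ⟨x⟩ hb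
    exact (congrArg LeafSpace.val h).symm

/-- The connected subsets of the leaf space which are contained in one orbit are second
countable. -/
theorem secondCountable_of_isPreconnected {C : Set (LeafSpace L)} (hC : IsPreconnected C)
    {ξ : LeafSpace L} (hξ : ξ ∈ C) : SecondCountableTopology C := by
  -- A finite spanning set makes the orbit of ξ clopen, locally Euclidean and σ-compact, hence
  -- second countable. The connected set `C` lies inside it.
  obtain ⟨Y, hY⟩ := (IsNoetherian.noetherian L.toSubmodule : L.toSubmodule.FG)
  have hYL : (Y : Set (A →L[ℝ] A)) ⊆ L := fun X hX => by
    have : X ∈ L.toSubmodule := hY ▸ Submodule.subset_span hX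
    exact this
  have hclopen := isClopen_orbit hY ξ
  let Ω : TopologicalSpace.Opens (LeafSpace L) := ⟨_, hclopen.isOpen⟩
  have hΩ : ∀ η ∈ Ω, Module.finrank ℝ (orbitDistribution L.toSubmodule η.val) =
      Module.finrank ℝ (orbitDistribution L.toSubmodule ξ.val) := by
    rintro _ ⟨g, hg, rfl⟩
    exact finrank_orbitDistribution_dualGroupAct (oneParamGroup_le hYL hg) _
  choose φ hφ _ using exists_chart Ω hΩ
  let _ := chartedSpaceOfCharts φ hφ
  have : SigmaCompactSpace Ω :=
    isSigmaCompact_iff_sigmaCompactSpace.1 (isSigmaCompact_orbit Y.finite_toSet hYL ξ)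
  have : SecondCountableTopology Ω := ChartedSpace.secondCountable_of_sigmaCompact
    (EuclideanSpace ℝ (Fin (Module.finrank ℝ (orbitDistribution L.toSubmodule ξ.val)))) Ω
  have hCΩ : C ⊆ Ω := hC.subset_isClopen hclopen
    ⟨ξ, hξ, 1, one_mem _, (LeafSpace.act_one ξ).symm⟩
  exact (Topology.IsEmbedding.inclusion hCΩ).secondCountableTopology

/-- The inclusion of an integral leaf of `η ↦ L · η` is an open embedding into the leaf space. -/
theorem IsIntegralLeaf.isOpenEmbedding {D : SmoothDistribution (StrongDual ℝ A)}
    {N : ImmersedSubmanifold (StrongDual ℝ A)} (hN : IsIntegralLeaf D N)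
    (hD : ∀ x, D.fiber (N.incl x) = orbitDistribution L.toSubmodule (N.incl x)) :
    Topology.IsOpenEmbedding fun x => (⟨N.incl x⟩ : LeafSpace L) := by
  have hnhds : ∀ x, Filter.map (fun x => (⟨N.incl x⟩ : LeafSpace L)) (𝓝 x) = 𝓝 ⟨N.incl x⟩ := by
    intro x
    set φ := chartAt (EuclideanSpace ℝ (Fin N.dim)) x
    have hx : x ∈ φ.source := mem_chart_source _ x
    have hpl := hN.isPlaque x
    have hpl' : IsPlaque (orbitDistribution L.toSubmodule) (N.incl ∘ φ.symm) φ.target :=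
      ⟨hpl.isOpen, hpl.contDiffAt, hpl.injective, fun b hb => (hpl.range_eq b hb).trans (hD _)⟩
    have h := hpl'.map_nhds (φ.map_source hx)
    rw [Function.comp_apply, φ.left_inv hx] at h
    rw [← h, ← φ.symm_map_nhds_eq hx, Filter.map_map]
    rfl
  refine Topology.IsOpenEmbedding.of_continuous_injective_isOpenMap
    (continuous_iff_continuousAt.2 fun x => (hnhds x).le)
    (fun x y h => N.injective (congrArg LeafSpace.val h))
    (isOpenMap_iff_nhds_le.2 fun x => (hnhds x).ge)

/-- An open subset of the leaf space on which `D` is `η ↦ L · η` is an integral leaf of `D`. -/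
theorem exists_leaf_of_isOpen {k : ℕ} {D : SmoothDistribution (StrongDual ℝ A)}
    (Ω : TopologicalSpace.Opens (LeafSpace L)) [SecondCountableTopology Ω]
    (hΩ : ∀ η ∈ Ω, Module.finrank ℝ (orbitDistribution L.toSubmodule η.val) = k)
    (hD : ∀ η ∈ Ω, D.fiber η.val = orbitDistribution L.toSubmodule η.val) :
    ∃ (N : ImmersedSubmanifold (StrongDual ℝ A)) (e : N.carrier ≃ₜ Ω),
      (∀ x, (e x).1.val = N.incl x) ∧ IsIntegralLeaf D N := by
  refine exists_leaf_of_plaques (M := Ω) (k := k) (f := fun η => η.1.val)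
    (fun η θ h => Subtype.ext (LeafSpace.ext h)) D fun x => ?_
  obtain ⟨φ, hx, hφ⟩ := exists_chart Ω hΩ x
  exact ⟨φ, hx, hφ.isOpen, hφ.contDiffAt, hφ.injective, fun b hb =>
    (hφ.range_eq b hb).trans (hD _ (φ.symm b).2).symm⟩

end Orbits

/-! ### The homogeneous topology of the orbit and the maximal leaf -/

section OrbitTopology

variable {A : Type u} [NormedAddCommGroup A] [NormedSpace ℝ A] [FiniteDimensional ℝ A]
  (mul : A →ₗ[ℝ] A →ₗ[ℝ] A) (ξ : StrongDual ℝ A)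

/-- The inclusion of the orbit into the leaf space. -/
def orbitIncl (η : orbit mul ξ) : LeafSpace (structureAlgebra mul) := ⟨η.1⟩

theorem orbitIncl_injective : Function.Injective (orbitIncl mul ξ) := fun _ _ h =>
  Subtype.ext (congrArg LeafSpace.val h)

theorem range_orbitIncl : Set.range (orbitIncl mul ξ) =
    {η | ∃ g ∈ expGroup (structureAlgebra mul), η = LeafSpace.act g ⟨ξ⟩} := by
  ext η
  constructor
  · rintro ⟨⟨_, g, rfl⟩, rfl⟩
    exact ⟨g.1, g.2, rfl⟩
  · rintro ⟨g, hg, rfl⟩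
    exact ⟨⟨_, ⟨g, hg⟩, rfl⟩, rfl⟩

theorem eventually_structureAlgebra_iff {p : (A →L[ℝ] A) → Prop} :
    (∀ᶠ X : structureAlgebra mul in 𝓝 0, p X) ↔
      ∀ᶠ X in 𝓝[structureAlgebra mul] (0 : A →L[ℝ] A), p X := by
  have : 𝓝[structureAlgebra mul] (0 : A →L[ℝ] A) =
      Filter.map ((↑) : structureAlgebra mul → A →L[ℝ] A) (𝓝 0) :=
    nhdsWithin_eq_map_subtype_coe (s := (structureAlgebra mul : Set (A →L[ℝ] A)))
      (structureAlgebra mul).zero_mem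
  rw [this, Filter.eventually_map]

/-- The topology of the orbit is the subspace topology of the leaf topology. -/
theorem isOpenEmbedding_orbitIncl :
    @Topology.IsOpenEmbedding _ _ (orbitTopology mul ξ) _ (orbitIncl mul ξ) := by
  let _ := structureGroupTopology mul
  let _ := orbitTopology mul ξ
  refine Topology.IsOpenEmbedding.of_continuous_injective_isOpenMap ?_
    (orbitIncl_injective mul ξ) ?_
  · refine continuous_coinduced_dom.2 (continuous_def.2 fun S hS => ?_)
    intro g hg
    have h1 : IsOpen (LeafSpace.act g.1 ⁻¹' S) := hS.preimage (LeafSpace.continuous_act g.2)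
    have h2 := LeafSpace.isOpen_iff.1 h1 ⟨ξ⟩ hg
    filter_upwards [(eventually_structureAlgebra_iff mul).2 h2] with X hX
    rw [Set.mem_preimage, ← LeafSpace.act_mul] at hX
    exact hX
  · intro U hU
    rw [LeafSpace.isOpen_iff]
    rintro _ ⟨⟨_, g, rfl⟩, hη, rfl⟩
    have h1 := (eventually_structureAlgebra_iff mul
      (p := fun X => ∃ θ ∈ U, orbitIncl mul ξ θ = LeafSpace.act (g.1 * expUnit X) ⟨ξ⟩)).1
      ((isOpen_coinduced.1 hU g hη).mono fun X hX => ⟨_, hX, rfl⟩)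
    -- The group topology perturbs `g` to g exp X, the leaf topology to (exp X) g. Replacing X by
    -- g⁻¹ X g passes from one to the other.
    filter_upwards [(tendsto_conj (inv_mem g.2)).eventually h1] with X hX
    obtain ⟨θ, hθ, h⟩ := hX
    refine ⟨θ, hθ, h.trans ?_⟩
    rw [expUnit_conj, inv_inv, ← mul_assoc, mul_inv_cancel_left, LeafSpace.act_mul]
    rfl

/-- The open subset of the leaf space formed by the regular points of the orbit. -/
def regularSet : Set (LeafSpace (structureAlgebra mul)) := orbitIncl mul ξ '' regularPart mul ξ

theorem regularSet_eq : regularSet mul ξ =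
    {η | ∃ g ∈ expGroup (structureAlgebra mul), η = LeafSpace.act g ⟨ξ⟩} ∩
      {η | orbitDistribution (leftMultiplications mul) η.val =
        orbitDistribution (structureAlgebra mul).toSubmodule η.val} := by
  rw [← range_orbitIncl]
  ext η
  constructor
  · rintro ⟨θ, hθ, rfl⟩
    exact ⟨⟨θ, rfl⟩, hθ⟩
  · rintro ⟨⟨θ, rfl⟩, hθ⟩
    exact ⟨θ, hθ, rfl⟩

theorem leftMultiplications_le : leftMultiplications mul ≤ (structureAlgebra mul).toSubmodule :=
  LieSubalgebra.subset_lieSpan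

theorem isOpen_regularSet : IsOpen (regularSet mul ξ) := by
  rw [regularSet_eq]
  exact (isClopen_expGroup_orbit _).isOpen.inter
    (isOpen_setOf_orbitDistribution_eq (leftMultiplications_le mul))

variable {mul ξ} in
-- The orbit is embedded in the leaf space, so the component of ξ may be computed there.
theorem image_regularComponent (hξ : basePoint mul ξ ∈ regularPart mul ξ) :
    orbitIncl mul ξ '' regularComponent mul ξ = connectedComponentIn (regularSet mul ξ) ⟨ξ⟩ := by
  let _ := orbitTopology mul ξ
  have hemb := isOpenEmbedding_orbitIncl mul ξ
  have hmem : (⟨ξ⟩ : LeafSpace (structureAlgebra mul)) ∈ regularSet mul ξ :=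
    ⟨basePoint mul ξ, hξ, rfl⟩
  apply Set.Subset.antisymm
  · refine IsPreconnected.subset_connectedComponentIn
      (isPreconnected_connectedComponentIn.image _ hemb.continuous.continuousOn)
      ⟨basePoint mul ξ, mem_connectedComponentIn hξ, rfl⟩
      (Set.image_mono (connectedComponentIn_subset _ _))
  · have hsub : connectedComponentIn (regularSet mul ξ) ⟨ξ⟩ ⊆ Set.range (orbitIncl mul ξ) :=
      (connectedComponentIn_subset _ _).trans (Set.image_subset_range _ _)
    rw [← Set.image_preimage_eq_of_subset hsub]
    refine Set.image_mono (IsPreconnected.subset_connectedComponentIn ?_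
      (mem_connectedComponentIn hmem) ?_)
    · rw [← hemb.isInducing.isPreconnected_image, Set.image_preimage_eq_of_subset hsub]
      exact isPreconnected_connectedComponentIn
    · intro η hη
      obtain ⟨θ, hθ, h⟩ := connectedComponentIn_subset _ _ hη
      rwa [← orbitIncl_injective mul ξ h]

theorem dualDistribution_fiber (η : StrongDual ℝ A) :
    (dualDistribution mul).fiber η = orbitDistribution (leftMultiplications mul) η := by
  ext θ
  constructor
  · rintro ⟨a, rfl⟩
    refine ⟨lmul mul (-a), ⟨-a, rfl⟩, ?_⟩
    ext b
    simp [dualAct_apply]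
  · rintro ⟨_, ⟨a, rfl⟩, rfl⟩
    refine ⟨-a, ?_⟩
    ext b
    simp [dualAct_apply]

theorem involutiveAt_of_integrableAt {D : SmoothDistribution (StrongDual ℝ A)}
    (h : IntegrableAt D ξ) : InvolutiveAt D ξ := by
  obtain ⟨N, hN, x, rfl⟩ := h
  intro X Y hX hY
  have h := (hN.isPlaque x).lieBracket_mem (mem_chart_target _ x) hX hY
  rwa [Function.comp_apply, OpenPartialHomeomorph.left_inv _ (mem_chart_source _ x)] at h

variable {mul ξ}

/-- If every integral leaf consists of regular points, the connected component of a regular point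
in the regular part of its orbit is the maximal integral leaf. -/
theorem maximalLeaf_of_regular
    (hreg : ∀ η, IntegrableAt (dualDistribution mul) η →
      orbitDistribution (leftMultiplications mul) η =
        orbitDistribution (structureAlgebra mul).toSubmodule η)
    (hξ : basePoint mul ξ ∈ regularPart mul ξ) :
    (∃ N, IsMaximalLeafThrough (dualDistribution mul) ξ N) ∧
      ∀ N, IsMaximalLeafThrough (dualDistribution mul) ξ N →
        IsOpenPartOfOrbit mul ξ N (regularComponent mul ξ) := by
  set C := connectedComponentIn (regularSet mul ξ) ⟨ξ⟩ with hC
  have hCpre : IsPreconnected C := isPreconnected_connectedComponentIn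
  have hξC : (⟨ξ⟩ : LeafSpace (structureAlgebra mul)) ∈ C :=
    mem_connectedComponentIn ⟨basePoint mul ξ, hξ, rfl⟩
  have hCreg : C ⊆ regularSet mul ξ := connectedComponentIn_subset _ _
  let Ω : TopologicalSpace.Opens (LeafSpace (structureAlgebra mul)) :=
    ⟨C, LeafSpace.isOpen_connectedComponentIn (isOpen_regularSet mul ξ) _⟩
  have : SecondCountableTopology Ω := secondCountable_of_isPreconnected hCpre hξC
  have hΩrank : ∀ η ∈ Ω, Module.finrank ℝ
      (orbitDistribution (structureAlgebra mul).toSubmodule η.val) =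
      Module.finrank ℝ (orbitDistribution (structureAlgebra mul).toSubmodule ξ) := by
    intro η hη
    have h := hCreg hη
    rw [regularSet_eq] at h
    obtain ⟨g, hg, rfl⟩ := h.1
    exact finrank_orbitDistribution_dualGroupAct hg ξ
  obtain ⟨N₀, e, he, hN₀⟩ := exists_leaf_of_isOpen (D := dualDistribution mul) Ω hΩrank
    fun η hη => by
      have h := hCreg hη
      rw [regularSet_eq] at h
      exact (dualDistribution_fiber mul η.val).trans h.2
  -- every connected leaf through `ξ` is an open part of the component
  have hleaf : ∀ N, IsConnectedLeafThrough (dualDistribution mul) ξ N →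
      Topology.IsOpenEmbedding
          (fun x => (⟨N.incl x⟩ : LeafSpace (structureAlgebra mul))) ∧
        Set.range (fun x => (⟨N.incl x⟩ : LeafSpace (structureAlgebra mul))) ⊆ C := by
    intro N hN
    have hNreg : ∀ x, orbitDistribution (leftMultiplications mul) (N.incl x) =
        orbitDistribution (structureAlgebra mul).toSubmodule (N.incl x) := fun x =>
      hreg _ ⟨N, hN.leaf, x, rfl⟩
    have hopen := hN.leaf.isOpenEmbedding fun x =>
      (dualDistribution_fiber mul (N.incl x)).trans (hNreg x)
    have hconn := hN.connected
    have hpre := isPreconnected_range hopen.continuous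
    obtain ⟨x₀, hx₀⟩ := hN.mem
    have hmem : (⟨ξ⟩ : LeafSpace (structureAlgebra mul)) ∈
        Set.range (fun x => (⟨N.incl x⟩ : LeafSpace (structureAlgebra mul))) :=
      ⟨x₀, LeafSpace.ext hx₀⟩
    -- A connected leaf cannot leave the clopen orbit, and all its points are regular.
    refine ⟨hopen, hpre.subset_connectedComponentIn hmem ?_⟩
    rw [regularSet_eq]
    refine Set.subset_inter (hpre.subset_isClopen (isClopen_expGroup_orbit _)
      ⟨_, hmem, 1, one_mem _, (LeafSpace.act_one _).symm⟩) ?_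
    rintro _ ⟨x, rfl⟩
    exact hNreg x
  have hN₀leaf : IsConnectedLeafThrough (dualDistribution mul) ξ N₀ := by
    refine ⟨hN₀, ?_, e.symm ⟨⟨ξ⟩, hξC⟩, ?_⟩
    · have : ConnectedSpace Ω := isConnected_iff_connectedSpace.1 ⟨⟨_, hξC⟩, hCpre⟩
      exact e.symm.surjective.connectedSpace e.symm.continuous
    · rw [← he, e.apply_symm_apply]
  have hemb₀ : Topology.IsOpenEmbedding fun x => ((e x : Ω) : LeafSpace (structureAlgebra mul)) :=
    Ω.isOpenEmbedding'.comp e.isOpenEmbedding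
  refine ⟨⟨N₀, hN₀leaf, fun N hN => ?_⟩, fun N hN => ?_⟩
  · obtain ⟨hopen, hrange⟩ := hleaf N hN
    have hval : ∀ x, ((e (e.symm ⟨⟨N.incl x⟩, hrange ⟨x, rfl⟩⟩) : Ω) :
        LeafSpace (structureAlgebra mul)) = ⟨N.incl x⟩ := fun x => by rw [e.apply_symm_apply]
    refine ⟨fun x => e.symm ⟨⟨N.incl x⟩, hrange ⟨x, rfl⟩⟩, ?_, fun x => ?_⟩
    · refine Topology.IsOpenEmbedding.of_comp _ hemb₀ ?_
      convert hopen using 1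
      exact funext hval
    · rw [← he, hval]
  · let _ := orbitTopology mul ξ
    obtain ⟨hopen, hrange⟩ := hleaf N hN.toIsConnectedLeafThrough
    -- An arbitrary maximal leaf contains the constructed leaf `N₀`, so its range is all of `C`.
    obtain ⟨j, -, hj⟩ := hN.maximal N₀ hN₀leaf
    have hrange' : Set.range (fun x => (⟨N.incl x⟩ : LeafSpace (structureAlgebra mul))) = C := by
      refine hrange.antisymm fun η hη => ⟨j (e.symm ⟨η, hη⟩), LeafSpace.ext ?_⟩
      change N.incl (j _) = _
      rw [hj, ← he, e.apply_symm_apply]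
    have hC' := image_regularComponent hξ
    rw [← hC] at hC'
    have hlift : ∀ x, ∃ θ ∈ regularComponent mul ξ, orbitIncl mul ξ θ = ⟨N.incl x⟩ := fun x => by
      have := hrange ⟨x, rfl⟩
      rwa [← hC'] at this
    choose i hi hiN using hlift
    refine ⟨i, ?_, fun x => congrArg LeafSpace.val (hiN x), ?_⟩
    · refine Topology.IsOpenEmbedding.of_comp _ (isOpenEmbedding_orbitIncl mul ξ) ?_
      convert hopen using 1
      exact funext hiN
    · apply (orbitIncl_injective mul ξ).image_injective
      rw [hC', ← hrange', ← Set.range_comp]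
      exact congrArg Set.range (funext hiN)

end OrbitTopology

/-! ### Condition 3 and regularity for Jordan algebras -/

section Jordan

variable {J : Type u} [NormedAddCommGroup J] [NormedSpace ℝ J] [FiniteDimensional ℝ J]
  {mul : J →ₗ[ℝ] J →ₗ[ℝ] J}

theorem act_jordanPart (hJ : IsJordan mul) (ξ : StrongDual ℝ J) :
    ExtAlgebra.act hJ (ExtAlgebra.jordanPart hJ) ξ =
      orbitDistribution (leftMultiplications mul) ξ := by
  ext θ
  constructor
  · rintro ⟨⟨d, x⟩, hX, rfl⟩
    change d = 0 at hX
    subst hX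
    exact ⟨lmul mul x, ⟨x, rfl⟩, by simp [ExtAlgebra.standardRep]⟩
  · rintro ⟨_, ⟨x, rfl⟩, rfl⟩
    exact ⟨⟨0, x⟩, rfl, by simp [ExtAlgebra.standardRep]⟩

theorem act_derPart (hJ : IsJordan mul) (ξ : StrongDual ℝ J) :
    ExtAlgebra.act hJ (ExtAlgebra.derPart hJ) ξ = orbitDistribution (innerDer mul) ξ := by
  ext θ
  constructor
  · rintro ⟨⟨d, x⟩, hX, rfl⟩
    change x = 0 at hX
    subst hX
    exact ⟨d, d.2, by simp [ExtAlgebra.standardRep]⟩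
  · rintro ⟨d, hd, rfl⟩
    exact ⟨⟨⟨d, hd⟩, 0⟩, rfl, by simp [ExtAlgebra.standardRep]⟩

/-- The right-hand side is the image of the extended structure algebra under its standard
representation. It is thus a Lie subalgebra containing m_J; conversely it is spanned by left
multiplications and their commutators. -/
theorem structureAlgebra_toSubmodule (hJ : IsJordan mul) :
    (structureAlgebra mul).toSubmodule = innerDer mul ⊔ leftMultiplications mul := by
  apply le_antisymm
  · have h1 : structureAlgebra mul ≤ (ExtAlgebra.standardRep hJ).range := by
      refine LieSubalgebra.lieSpan_le.2 ?_
      rintro _ ⟨x, rfl⟩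
      exact ⟨⟨0, x⟩, by simp [ExtAlgebra.standardRep]⟩
    intro X hX
    obtain ⟨⟨d, x⟩, rfl⟩ := h1 hX
    exact Submodule.add_mem_sup d.2 ⟨x, rfl⟩
  · refine sup_le ?_ (leftMultiplications_le mul)
    refine Submodule.span_le.2 ?_
    rintro _ ⟨x, y, rfl⟩
    exact (structureAlgebra mul).lie_mem (leftMultiplications_le mul ⟨x, rfl⟩)
      (leftMultiplications_le mul ⟨y, rfl⟩)

/-- `Der₀(J) · ξ ⊆ J · ξ` if and only if `ξ` is a regular point of its orbit. -/
theorem act_le_iff_regular (hJ : IsJordan mul) (ξ : StrongDual ℝ J) :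
    ExtAlgebra.act hJ (ExtAlgebra.derPart hJ) ξ ≤ ExtAlgebra.act hJ (ExtAlgebra.jordanPart hJ) ξ ↔
      orbitDistribution (leftMultiplications mul) ξ =
        orbitDistribution (structureAlgebra mul).toSubmodule ξ := by
  rw [act_derPart, act_jordanPart, structureAlgebra_toSubmodule hJ]
  simp only [orbitDistribution, Submodule.map_sup]
  exact (right_eq_sup (a := Submodule.map (dualAct ξ) (innerDer mul))).symm

theorem isSection_sharp (mul : J →ₗ[ℝ] J →ₗ[ℝ] J) (a : J) :
    IsSection (dualDistribution mul).fiber fun η => sharp mul η a :=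
  ⟨contDiff_id.clm_comp contDiff_const, fun _ => ⟨a, rfl⟩⟩

theorem lieBracket_sharp (mul : J →ₗ[ℝ] J →ₗ[ℝ] J) (a b : J) (ξ : StrongDual ℝ J) :
    VectorField.lieBracket ℝ (fun η => sharp mul η a) (fun η => sharp mul η b) ξ =
      dualAct ξ (-⁅lmul mul a, lmul mul b⁆) := by
  have h : ∀ c (η : StrongDual ℝ J), fderiv ℝ (fun η => sharp mul η c) ξ η = sharp mul η c := by
    intro c η
    have : (fun η => sharp mul η c) =
        ((ContinuousLinearMap.compL ℝ J J ℝ).flip (lmul mul c) : StrongDual ℝ J → _) := rfl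
    rw [this, ContinuousLinearMap.fderiv]
    rfl
  rw [VectorField.lieBracket, h, h]
  ext c
  simp [dualAct_apply, lie_apply]

/-- Testing involutivity on the linear fields `sharp mul η a` suffices, since their brackets at ξ
are, up to sign, [l_a, l_b] · ξ. -/
theorem act_le_of_involutiveAt (hJ : IsJordan mul) {ξ : StrongDual ℝ J}
    (h : InvolutiveAt (dualDistribution mul) ξ) :
    ExtAlgebra.act hJ (ExtAlgebra.derPart hJ) ξ ≤
      ExtAlgebra.act hJ (ExtAlgebra.jordanPart hJ) ξ := by
  rw [act_derPart, act_jordanPart, orbitDistribution, Submodule.map_le_iff_le_comap]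
  refine Submodule.span_le.2 ?_
  rintro _ ⟨a, b, rfl⟩
  have h1 := h _ _ (isSection_sharp mul a) (isSection_sharp mul b)
  rw [dualDistribution_fiber, lieBracket_sharp, map_neg] at h1
  exact (neg_mem_iff.1 h1 :)

/-- Applied at every point of a leaf, this shows that leaves of H^J are integral manifolds of η ↦
g(J) · η. -/
theorem regular_of_integrableAt (hJ : IsJordan mul) {ξ : StrongDual ℝ J}
    (h : IntegrableAt (dualDistribution mul) ξ) :
    orbitDistribution (leftMultiplications mul) ξ =
      orbitDistribution (structureAlgebra mul).toSubmodule ξ :=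
  (act_le_iff_regular hJ ξ).1 (act_le_of_involutiveAt hJ (involutiveAt_of_integrableAt ξ h))

end Jordan

end

end JordanDist

theorem mainTheorem5 {J : Type u} [NormedAddCommGroup J] [NormedSpace ℝ J] [FiniteDimensional ℝ J]
    (mul : J →ₗ[ℝ] J →ₗ[ℝ] J) (hJ : JordanDist.IsJordan mul) (ξ : StrongDual ℝ J) :
    List.TFAE
      [JordanDist.InvolutiveAt (JordanDist.dualDistribution mul) ξ,
       JordanDist.IntegrableAt (JordanDist.dualDistribution mul) ξ,
       JordanDist.ExtAlgebra.act hJ (JordanDist.ExtAlgebra.derPart hJ) ξ ≤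
         JordanDist.ExtAlgebra.act hJ (JordanDist.ExtAlgebra.jordanPart hJ) ξ] ∧
    (JordanDist.IntegrableAt (JordanDist.dualDistribution mul) ξ →
      (∃ N : JordanDist.ImmersedSubmanifold (StrongDual ℝ J),
        JordanDist.IsMaximalLeafThrough (JordanDist.dualDistribution mul) ξ N) ∧
      ∀ N : JordanDist.ImmersedSubmanifold (StrongDual ℝ J),
        JordanDist.IsMaximalLeafThrough (JordanDist.dualDistribution mul) ξ N →
          JordanDist.IsOpenPartOfOrbit mul ξ N (JordanDist.regularComponent mul ξ)) := by
  have hreg := fun η => JordanDist.regular_of_integrableAt (ξ := η) hJ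
  constructor
  · tfae_have 1 → 3 := JordanDist.act_le_of_involutiveAt hJ
    -- At a regular point the component of the regular part is itself a leaf.
    tfae_have 3 → 2 := fun h => by
      obtain ⟨N, hN⟩ := (JordanDist.maximalLeaf_of_regular hreg
        ((JordanDist.act_le_iff_regular hJ ξ).1 h)).1
      exact ⟨N, hN.leaf, hN.mem⟩
    tfae_have 2 → 1 := JordanDist.involutiveAt_of_integrableAt ξ
    tfae_finish
  · exact fun h => JordanDist.maximalLeaf_of_regular hreg (hreg ξ h)
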